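/- **Setting.** A Jacobi matrix is given by bounded real sequences $a,b$ on $\mathbb Z$ with $\inf_m a_m>0$; it acts on $\ell^2(\mathbb Z)$ by $(\mathscr J\phi)_m=a_{m-1}\phi_{m-1}+b_m\phi_m+a_m\phi_{m+1}$. Let $R>0$, and let $\mathcal J(R)$ be the set of Jacobi matrices with $1/R\le a_m\le R$ and $|b_m|\le R$ for all $m\in\mathbb Z$. A Jacobi matrix is $q$-periodic if $a_{m+q}=a_m$ and $b_{m+q}=b_m$ for all $m$. For a $q$-periodic $\mathscr J$ ($q\ge1$) and $\theta\in\mathbb R$ let $\mathscr J(\theta)$ be the Hermitian $q\times q$ Floquet matrix, with rows and columns indexed by $0,\dots,q-1$: diagonal entries $b_0,\dots,b_{q-1}$, off-diagonal entries $a_0,\dots,a_{q-2}$, lower left corner entry $a_{q-1}e^{2\pi i\theta}$ and upper right corner entry $a_{q-1}e^{-2\pi i\theta}$ (coinciding entries being added if $q\le2$). Let $\lambda_{q,0}(\theta)\le\dots\le\lambda_{q,q-1}(\theta)$ be its eigenvalues, with multiplicity, $P_k(\theta)$ the orthogonal projection of $\mathbb C^q$ onto $\ker(\mathscr J(\theta)-\lambda_{q,k}(\theta))$,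 and $$Q_q(\theta)=\frac{q}{2\pi}\sum_{k=0}^{q-1}\frac{d\lambda_{q,k}}{d\theta}(\theta)\,P_k(\theta),\qquad \theta\in[0,1)\setminus\{0,\tfrac12\}.$$ Let $\mathcal F_q:\ell^2(\mathbb Z)\to L^2([0,1);\mathbb C^q)$ be the unitary Floquet transform, $[\mathcal F_q\phi]_k(\theta)=\sum_{p\in\mathbb Z}\phi_{k+pq}e^{-2\pi ip\theta}$ for $0\le k\le q-1$, and let $Q_q=\mathcal F_q^{-1}\big(\int^{\oplus}_{[0,1)}Q_q(\theta)\,d\theta\big)\mathcal F_q$. Let $X$ be the position operator, $(X\phi)_m=m\phi_m$, with domain $\mathfrak D(X)=\{\phi\in\ell^2(\mathbb Z):(m\phi_m)_m\in\ell^2(\mathbb Z)\}$, and let $X_{\mathscr J}(t)=e^{it\mathscr J}Xe^{-it\mathscr J}$ be its Heisenberg evolution, with domain $\{\phi:e^{-it\mathscr J}\phi\in\mathfrak D(X)\}$. **Statement.** For every $R>0$ there is a constant $c_1>0$, depending only on $R$, with the property (L) $\ |\tfrac{d}{d\theta}\lambda_{q,k}(\theta)|\ge e^{-c_1q}|\sin2\pi\theta|$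 for all $q\ge1$, all $q$-periodic $\mathscr J\in\mathcal J(R)$, all $0\le k\le q-1$ and all $\theta\in\mathbb R\setminus\frac12\mathbb Z$. Moreover, for every $c_1>0$ with property (L) the following holds. Let $\eta>7c_1$ and $\mathscr J\in\mathcal J(R)$. Let $q_0,q_1,\dots$ be positive integers with $q_n\mid q_{n+1}$ and $q_n\ne q_{n+1}$ for all $n\ge 0$, and let $\mathscr J_{q_n}$ be $q_n$-periodic Jacobi matrices with $\mathscr J_{q_n}\in\mathcal J(R)$ for all large $n$ and $$\lim_{n\to\infty}q_{n+1}^3e^{\eta q_n}\|\mathscr J-\mathscr J_{q_n}\|=0.$$ Put $\gamma_n=e^{-\eta q_{n-1}}/q_n^3$ for $n\ge1$, and let $Q_{q_n}$ be the operator defined above for $\mathscr J_{q_n}$ and $q_n$. Then there is $N\ge1$ such that for every $n\ge N$ the family $\theta\mapsto Q_{q_n}(\theta)$ is measurable and essentially bounded (so that $Q_{q_n}$ is a well-defined bounded operator on $\ell^2(\mathbb Z)$), and for all $t>0$, all $\varepsilon>\gamma_n$ and all $\varphi\in\ell^1(\mathbb Z)\cap\mathfrak D(X)$ one has $\varphi\in\mathfrak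 D(X_{\mathscr J_{q_n}}(t))$ and $$\Big\|Q_{q_n}\varphi-\frac1tX_{\mathscr J_{q_n}}(t)\varphi\Big\|\le\frac1t\|X\varphi\|+\|\varphi\|_{\ell^1}\left(\frac{4R^2q_n^2}{t^2\varepsilon^2}+16R^2q_n\,e^{c_1q_{n-1}/2}\sqrt{\varepsilon}\right)^{1/2}.$$ -/

import Mathlib

open Real Set Filter Topology MeasureTheory
open scoped ENNReal

noncomputable section

namespace JacobiTransport

/-- The Hilbert space `ℓ²(ℤ)` of complex sequences. -/
abbrev L2Z : Type := lp (fun _ : ℤ => ℂ) 2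

/-! ### Jacobi matrices -/

lemma weightedShift_memlp (d : ℤ → ℝ) (k : ℤ) {C : ℝ} (hC : ∀ n, |d n| ≤ C) (φ : L2Z) :
    Memℓp (fun n : ℤ => (d n : ℂ) * φ (n + k)) 2 ∧
      ∑' n : ℤ, ‖(d n : ℂ) * φ (n + k)‖ ^ (2 : ℝ≥0∞).toReal ≤
        (C * ‖φ‖) ^ (2 : ℝ≥0∞).toReal := by
  have h2 : (0 : ℝ) < (2 : ℝ≥0∞).toReal := by simp
  have hC0 : 0 ≤ C := (abs_nonneg (d 0)).trans (hC 0)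
  have hs := lp.hasSum_norm h2 φ
  have hs' : HasSum (fun n : ℤ => C ^ (2 : ℝ≥0∞).toReal * ‖φ (n + k)‖ ^ (2 : ℝ≥0∞).toReal)
      ((C * ‖φ‖) ^ (2 : ℝ≥0∞).toReal) := by
    rw [Real.mul_rpow hC0 (norm_nonneg _)]
    exact ((Equiv.addRight k).hasSum_iff.mpr hs).mul_left _
  have hle : ∀ n : ℤ, ‖(d n : ℂ) * φ (n + k)‖ ^ (2 : ℝ≥0∞).toReal ≤
      C ^ (2 : ℝ≥0∞).toReal * ‖φ (n + k)‖ ^ (2 : ℝ≥0∞).toReal := by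
    intro n
    rw [← Real.mul_rpow hC0 (norm_nonneg _)]
    refine Real.rpow_le_rpow (norm_nonneg _) ?_ h2.le
    rw [norm_mul, Complex.norm_real, Real.norm_eq_abs]
    exact mul_le_mul_of_nonneg_right (hC n) (norm_nonneg _)
  have hsum : Summable fun n : ℤ => ‖(d n : ℂ) * φ (n + k)‖ ^ (2 : ℝ≥0∞).toReal :=
    Summable.of_nonneg_of_le (fun n => by positivity) hle hs'.summable
  exact ⟨memℓp_gen hsum, (hsum.tsum_le_tsum hle hs'.summable).trans hs'.tsum_eq.le⟩

/-- The bounded operator `(Tφ)_n = d_n φ_{n+k}` on `ℓ²(ℤ)`, for a bounded real sequence `d`. -/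
def weightedShift (d : ℤ → ℝ) (k : ℤ) (hd : ∃ C, ∀ n, |d n| ≤ C) : L2Z →L[ℂ] L2Z :=
  LinearMap.mkContinuousOfExistsBound
    { toFun := fun φ =>
        ⟨fun n => (d n : ℂ) * φ (n + k), (weightedShift_memlp d k hd.choose_spec φ).1⟩
      map_add' := fun φ ψ => by
        ext n
        exact mul_add (d n : ℂ) (φ (n + k)) (ψ (n + k))
      map_smul' := fun c φ => by
        ext n
        exact mul_left_comm (d n : ℂ) c (φ (n + k)) }
    ⟨hd.choose, fun φ => lp.norm_le_of_tsum_le (by simp)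
      (mul_nonneg ((abs_nonneg (d 0)).trans (hd.choose_spec 0)) (norm_nonneg φ))
      (weightedShift_memlp d k hd.choose_spec φ).2⟩

/-- The coefficients of a Jacobi matrix: bounded real sequences `a, b` on `ℤ` with
`inf a > 0`. -/
structure JacobiMatrix where
  a : ℤ → ℝ
  b : ℤ → ℝ
  bdd_a : ∃ C, ∀ n, |a n| ≤ C
  bdd_b : ∃ C, ∀ n, |b n| ≤ C
  a_pos : ∃ δ > 0, ∀ n, δ ≤ a n

namespace JacobiMatrix

/-- The bounded operator on `ℓ²(ℤ)` given by a Jacobi matrix,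
`(Jφ)_n = a_{n-1} φ_{n-1} + b_n φ_n + a_n φ_{n+1}`. -/
def op (J : JacobiMatrix) : L2Z →L[ℂ] L2Z :=
  weightedShift (fun n => J.a (n - 1)) (-1) (J.bdd_a.imp fun _ h n => h (n - 1)) +
    weightedShift J.b 0 J.bdd_b + weightedShift J.a 1 J.bdd_a

lemma op_apply (J : JacobiMatrix) (φ : L2Z) (n : ℤ) :
    J.op φ n = (J.a (n - 1) : ℂ) * φ (n - 1) + (J.b n : ℂ) * φ n + (J.a n : ℂ) * φ (n + 1) := by
  have h0 : ∀ m : ℤ, m + 0 = m := fun m => add_zero m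
  change (J.a (n - 1) : ℂ) * φ (n + -1) + (J.b n : ℂ) * φ (n + 0) + (J.a n : ℂ) * φ (n + 1) = _
  rw [h0, sub_eq_add_neg]

/-- The class `𝒥(R)`: `1/R ≤ a_n ≤ R` and `|b_n| ≤ R` for all `n`. -/
def IsRBounded (R : ℝ) (J : JacobiMatrix) : Prop :=
  ∀ n : ℤ, 1 / R ≤ J.a n ∧ J.a n ≤ R ∧ |J.b n| ≤ R

/-- `q`-periodicity of the coefficients. -/
def IsPeriodic (q : ℕ) (J : JacobiMatrix) : Prop :=
  ∀ n : ℤ, J.a (n + q) = J.a n ∧ J.b (n + q) = J.b n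

/-- The data of exponential-class limit-periodicity: `q₀ ∣ q₁ ∣ …` with `q_n ≠ q_{n+1}`,
`Jq n` is `q_n`-periodic and `q_{n+1}³ exp(η q_n) ‖J - Jq n‖ → 0` (operator norm). -/
structure IsExpApprox (η : ℝ) (J : JacobiMatrix) (q : ℕ → ℕ) (Jq : ℕ → JacobiMatrix) :
    Prop where
  dvd : ∀ n, q n ∣ q (n + 1)
  ne : ∀ n, q n ≠ q (n + 1)
  periodic : ∀ n, (Jq n).IsPeriodic (q n)
  tendsto : Tendsto (fun n => (q (n + 1) : ℝ) ^ 3 * Real.exp (η * q n) * ‖J.op - (Jq n).op‖)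
    atTop (𝓝 0)

/-- The Schrödinger propagator `e^{itJ}`. -/
def propagator (J : JacobiMatrix) (t : ℝ) : L2Z →L[ℂ] L2Z :=
  NormedSpace.exp ((Complex.I * (t : ℂ)) • J.op)

end JacobiMatrix

/-! ### The position operator and its Heisenberg evolution -/

/-- The position operator `(Xφ)_n = n φ_n` with its maximal domain
`D(X) = {φ ∈ ℓ²(ℤ) : (n φ_n) ∈ ℓ²(ℤ)}`. -/
def positionOp : L2Z →ₗ.[ℂ] L2Z where
  domain :=
    { carrier := {φ | Memℓp (fun n : ℤ => (n : ℂ) * φ n) 2}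
      add_mem' := fun {φ ψ} hφ hψ => by
        have h : (fun n : ℤ => (n : ℂ) * (φ + ψ : L2Z) n) =
            (fun n : ℤ => (n : ℂ) * φ n) + fun n : ℤ => (n : ℂ) * ψ n := by
          ext n
          simp [mul_add]
        change Memℓp _ 2
        rw [h]
        exact Memℓp.add hφ hψ
      zero_mem' := by
        have h : (fun n : ℤ => (n : ℂ) * (0 : L2Z) n) = 0 := by
          ext n
          simp
        change Memℓp _ 2
        rw [h]
        exact zero_memℓp
      smul_mem' := fun c φ hφ => by
        have h : (fun n : ℤ => (n : ℂ) * (c • φ : L2Z) n) =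
            c • fun n : ℤ => (n : ℂ) * φ n := by
          ext n
          simp [mul_left_comm]
        change Memℓp _ 2
        rw [h]
        exact Memℓp.const_smul hφ c }
  toFun :=
    { toFun := fun φ => ⟨fun n : ℤ => (n : ℂ) * (φ : L2Z) n, φ.2⟩
      map_add' := fun φ ψ => by
        ext n
        exact mul_add (n : ℂ) ((φ : L2Z) n) ((ψ : L2Z) n)
      map_smul' := fun c φ => by
        ext n
        exact mul_left_comm (n : ℂ) c ((φ : L2Z) n) }

/-- The Heisenberg evolution `X_J(t) = e^{itJ} X e^{-itJ}` of the position operator, with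
domain `{φ : e^{-itJ} φ ∈ D(X)}`. -/
def heisenbergX (J : JacobiMatrix) (t : ℝ) : L2Z →ₗ.[ℂ] L2Z where
  domain := positionOp.domain.comap (J.propagator (-t)).toLinearMap
  toFun := (J.propagator t).toLinearMap ∘ₗ positionOp.toFun ∘ₗ
    (J.propagator (-t)).toLinearMap.submoduleComap positionOp.domain

/-- The `ℓ¹` norm `∑ |φ_n|` (meaningful for `φ ∈ ℓ¹(ℤ)`). -/
def l1norm (φ : L2Z) : ℝ := ∑' n : ℤ, ‖φ n‖

/-! ### Floquet theory -/

/-- The fibre `ℂ^q` with its Euclidean inner product. -/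
abbrev Fibre (q : ℕ) : Type := EuclideanSpace ℂ (Fin q)

/-- Floquet space `L²(𝕋; ℂ^q)`, where `𝕋 = ℝ/ℤ` carries Lebesgue (= normalized Haar) measure. -/
abbrev FloquetSpace (q : ℕ) : Type :=
  Lp (Fibre q) 2 (AddCircle.haarAddCircle : Measure UnitAddCircle)

/-- For `n = k + p q` with `0 ≤ k < q`, the function `θ ↦ e^{-2πipθ} e_k` in Floquet space. -/
def floquetVec (q : ℕ) [NeZero q] (n : ℤ) : FloquetSpace q :=
  (ContinuousLinearMap.toSpanSingleton ℂ
      (EuclideanSpace.single (Int.divModEquiv q n).2 (1 : ℂ) : Fibre q)).compLp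
    (fourierLp 2 (-(Int.divModEquiv q n).1) : Lp ℂ 2 AddCircle.haarAddCircle)

lemma floquetVec_coe (q : ℕ) [NeZero q] (n : ℤ) :
    floquetVec q n =ᵐ[AddCircle.haarAddCircle] fun θ : UnitAddCircle =>
      fourier (-(Int.divModEquiv q n).1) θ •
        (EuclideanSpace.single (Int.divModEquiv q n).2 (1 : ℂ) : Fibre q) := by
  filter_upwards [ContinuousLinearMap.coeFn_compLp
    (ContinuousLinearMap.toSpanSingleton ℂ
      (EuclideanSpace.single (Int.divModEquiv q n).2 (1 : ℂ) : Fibre q))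
    (fourierLp 2 (-(Int.divModEquiv q n).1) : Lp ℂ 2 AddCircle.haarAddCircle),
    coeFn_fourierLp (T := 1) 2 (-(Int.divModEquiv q n).1)] with θ h1 h2
  rw [floquetVec, h1, h2]
  simp

lemma inner_floquetVec (q : ℕ) [NeZero q] (n : ℤ) (f : FloquetSpace q) :
    inner ℂ (floquetVec q n) f =
      inner ℂ (fourierLp 2 (-(Int.divModEquiv q n).1) : Lp ℂ 2 AddCircle.haarAddCircle)
        ((EuclideanSpace.proj (𝕜 := ℂ) (ι := Fin q)
          (Int.divModEquiv q n).2).compLp f) := by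
  rw [L2.inner_def, L2.inner_def]
  refine integral_congr_ae ?_
  filter_upwards [floquetVec_coe q n,
    coeFn_fourierLp (T := 1) 2 (-(Int.divModEquiv q n).1),
    ContinuousLinearMap.coeFn_compLp (EuclideanSpace.proj (𝕜 := ℂ) (ι := Fin q)
      (Int.divModEquiv q n).2) f] with θ h1 h2 h3
  rw [h1, h2, h3, inner_smul_left, EuclideanSpace.inner_single_left]
  simp [mul_comm]

lemma orthonormal_floquetVec (q : ℕ) [NeZero q] : Orthonormal ℂ (floquetVec q) := by
  have hF := orthonormal_iff_ite.mp (orthonormal_fourier (T := 1))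
  rw [orthonormal_iff_ite]
  intro m n
  rw [L2.inner_def]
  have key : ∫ θ, inner ℂ (floquetVec q m θ) (floquetVec q n θ) ∂AddCircle.haarAddCircle =
      inner ℂ (EuclideanSpace.single (Int.divModEquiv q m).2 (1 : ℂ) : Fibre q)
        (EuclideanSpace.single (Int.divModEquiv q n).2 (1 : ℂ)) *
      inner ℂ (fourierLp 2 (-(Int.divModEquiv q m).1) : Lp ℂ 2 AddCircle.haarAddCircle)
        (fourierLp (T := 1) 2 (-(Int.divModEquiv q n).1)) := by
    rw [L2.inner_def, ← integral_const_mul]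
    refine integral_congr_ae ?_
    filter_upwards [floquetVec_coe q m, floquetVec_coe q n,
      coeFn_fourierLp (T := 1) 2 (-(Int.divModEquiv q m).1),
      coeFn_fourierLp (T := 1) 2 (-(Int.divModEquiv q n).1)] with θ h1 h2 h3 h4
    rw [h1, h2, h3, h4, inner_smul_left, inner_smul_right]
    simp only [RCLike.inner_apply]
    ring
  rw [key, hF, EuclideanSpace.inner_single_left]
  by_cases h : m = n
  · subst h
    simp
  · have h' : Int.divModEquiv q m ≠ Int.divModEquiv q n :=
      fun e => h ((Int.divModEquiv q).injective e)
    rw [if_neg h]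
    by_cases h1 : (Int.divModEquiv q m).1 = (Int.divModEquiv q n).1
    · have h2 : (Int.divModEquiv q m).2 ≠ (Int.divModEquiv q n).2 :=
        fun e => h' (Prod.ext h1 e)
      simp [-Int.divModEquiv_apply, h2]
    · have h3 : -(Int.divModEquiv q m).1 ≠ -(Int.divModEquiv q n).1 :=
        fun e => h1 (neg_injective e)
      rw [if_neg h3, mul_zero]

lemma floquetVec_total (q : ℕ) [NeZero q] :
    (Submodule.span ℂ (Set.range (floquetVec q)))ᗮ = ⊥ := by
  rw [Submodule.eq_bot_iff]
  intro f hf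
  have h0 : ∀ n, inner ℂ (floquetVec q n) f = 0 := fun n =>
    (Submodule.mem_orthogonal _ f).mp hf _ (Submodule.subset_span ⟨n, rfl⟩)
  have hk : ∀ k : Fin q,
      (EuclideanSpace.proj (𝕜 := ℂ) (ι := Fin q) k).compLp f = 0 := by
    intro k
    apply (fourierBasis (T := 1)).repr.injective
    ext p
    rw [HilbertBasis.repr_apply_apply, coe_fourierBasis, map_zero]
    have h := h0 ((Int.divModEquiv q).symm (-p, k))
    rw [inner_floquetVec] at h
    simp only [Equiv.apply_symm_apply, neg_neg] at h
    exact h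
  rw [Lp.eq_zero_iff_ae_eq_zero]
  have hall : ∀ᵐ θ ∂(AddCircle.haarAddCircle : Measure UnitAddCircle), ∀ k : Fin q,
      f θ k = 0 := by
    rw [ae_all_iff]
    intro k
    filter_upwards [ContinuousLinearMap.coeFn_compLp
      (EuclideanSpace.proj (𝕜 := ℂ) (ι := Fin q) k) f,
      (Lp.eq_zero_iff_ae_eq_zero).mp (hk k)] with θ h1 h2
    rw [h2] at h1
    exact h1.symm
  filter_upwards [hall] with θ h
  ext k
  exact h k

/-- The `q`-periodic Floquet transform, the unitary map `𝓕 : ℓ²(ℤ) → L²(𝕋; ℂ^q)` with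
`[𝓕 φ]_k(θ) = ∑_p φ_{k+pq} e^{-2πipθ}` for `0 ≤ k < q`; that is, it sends `δ_{k+pq}` to
`e^{-2πipθ} e_k`. -/
def floquetTransform (q : ℕ) [NeZero q] : L2Z ≃ₗᵢ[ℂ] FloquetSpace q :=
  (HilbertBasis.mkOfOrthogonalEqBot (orthonormal_floquetVec q) (floquetVec_total q)).repr.symm

/-- The Floquet matrix `J_q(θ)`, with rows and columns indexed by `0, …, q-1`. It is the
tridiagonal block of `J` with the corner entries `a_{q-1} e^{2πiθ}` (last row, first column) and
`a_{q-1} e^{-2πiθ}` (first row, last column); for `q ≤ 2` coinciding entries are added. -/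
def floquetMatrix (q : ℕ) (J : JacobiMatrix) (θ : ℝ) : Matrix (Fin q) (Fin q) ℂ :=
  Matrix.of fun j k =>
    (if j = k then (J.b j : ℂ) else 0) +
    (if (j : ℕ) + 1 = k then (J.a j : ℂ) else 0) +
    (if (k : ℕ) + 1 = j then (J.a k : ℂ) else 0) +
    (if (j : ℕ) + 1 = q ∧ (k : ℕ) = 0 then
      (J.a j : ℂ) * Complex.exp (2 * π * θ * Complex.I) else 0) +
    (if (k : ℕ) + 1 = q ∧ (j : ℕ) = 0 then
      (J.a k : ℂ) * Complex.exp (-(2 * π * θ * Complex.I)) else 0)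

lemma floquetMatrix_isHermitian (q : ℕ) (J : JacobiMatrix) (θ : ℝ) :
    (floquetMatrix q J θ).IsHermitian := by
  ext j k
  have e1 : (starRingEnd ℂ) (Complex.exp (2 * π * θ * Complex.I)) =
      Complex.exp (-(2 * π * θ * Complex.I)) := by
    rw [← Complex.exp_conj]
    simp only [map_mul, Complex.conj_ofReal, Complex.conj_I, map_ofNat, mul_neg]
  have e2 : (starRingEnd ℂ) (Complex.exp (-(2 * π * θ * Complex.I))) =
      Complex.exp (2 * π * θ * Complex.I) := by
    rw [← e1, Complex.conj_conj]
  simp only [floquetMatrix, Matrix.conjTranspose_apply, Matrix.of_apply, RCLike.star_def,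
    map_add, apply_ite (starRingEnd ℂ), map_mul, map_zero, Complex.conj_ofReal, e1, e2]
  by_cases h : j = k
  · subst h
    simp only [if_true]
    ring
  · rw [if_neg h, if_neg (Ne.symm h)]
    ring

/-- The eigenvalues `λ_{q,0}(θ) ≤ … ≤ λ_{q,q-1}(θ)` of `J_q(θ)`, in increasing order and
repeated according to multiplicity. -/
def floquetEig (q : ℕ) (J : JacobiMatrix) (k : Fin q) (θ : ℝ) : ℝ :=
  (floquetMatrix_isHermitian q J θ).eigenvalues₀ (Fin.cast (Fintype.card_fin q).symm k.rev)

/-- The orthogonal projection `P_k(θ)` of `ℂ^q` onto `ker (J_q(θ) - λ_{q,k}(θ))`. -/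
def floquetProj (q : ℕ) (J : JacobiMatrix) (k : Fin q) (θ : ℝ) : Fibre q →L[ℂ] Fibre q :=
  (Module.End.eigenspace (Matrix.toEuclideanLin (floquetMatrix q J θ))
    (floquetEig q J k θ : ℂ)).starProjection

/-- The fibre operator `Q_q(θ) = (q / 2π) ∑_k λ'_{q,k}(θ) P_k(θ)`; here `λ'_{q,k}` is the
derivative in `θ ∈ [0,1)`, so that `λ'_{q,k} / 2π` is the derivative in the phase `2πθ`. -/
def fibreQ (q : ℕ) (J : JacobiMatrix) (θ : ℝ) : Fibre q →L[ℂ] Fibre q :=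
  ((q : ℂ) / (2 * π)) • ∑ k : Fin q, ((deriv (floquetEig q J k) θ : ℝ) : ℂ) • floquetProj q J k θ

/-- The fibre operators as a function on the circle `𝕋`, identified with `[0,1)`. -/
def circleQ (q : ℕ) (J : JacobiMatrix) (θ : UnitAddCircle) : Fibre q →L[ℂ] Fibre q :=
  fibreQ q J (AddCircle.equivIco 1 0 θ : ℝ)

/-- The decomposable operator `∫^⊕ M(θ) dθ` on Floquet space, `f ↦ (θ ↦ M(θ) f(θ))`, for a
measurable essentially bounded family `M` of operators on `ℂ^q` (and `0` for any other `M`). -/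
def directIntegral (q : ℕ) (M : UnitAddCircle → Fibre q →L[ℂ] Fibre q) :
    FloquetSpace q →L[ℂ] FloquetSpace q :=
  open Classical in
  if h : MemLp M ∞ (AddCircle.haarAddCircle : Measure UnitAddCircle) then
    (ContinuousLinearMap.id ℂ (Fibre q →L[ℂ] Fibre q)).holderL AddCircle.haarAddCircle ∞ 2 2
      (h.toLp M)
  else 0

/-- The operator `Q_q = 𝓕⁻¹ (∫^⊕ Q_q(θ) dθ) 𝓕` on `ℓ²(ℤ)` of a `q`-periodic Jacobi matrix. -/
def opQ (q : ℕ) [NeZero q] (J : JacobiMatrix) : L2Z →L[ℂ] L2Z :=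
  (floquetTransform q).symm.toContinuousLinearEquiv.toContinuousLinearMap ∘L
    directIntegral q (circleQ q J) ∘L
    (floquetTransform q).toContinuousLinearEquiv.toContinuousLinearMap

/-- `c` is a constant for Last's lower bound on the class `𝒥(R)`: for every `q ≥ 1`, every
`q`-periodic `J ∈ 𝒥(R)`, every `k` and every `θ`, `|λ'_{q,k}(θ)| ≥ e^{-cq} |sin 2πθ|`. -/
def IsLastConstant (R c : ℝ) : Prop :=
  ∀ (q : ℕ) (J : JacobiMatrix), 1 ≤ q → J.IsPeriodic q → J.IsRBounded R →
    ∀ (k : Fin q) (θ : ℝ),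
      Real.exp (-(c * q)) * |Real.sin (2 * π * θ)| ≤ |deriv (floquetEig q J k) θ|

/-- `γ_n = e^{-η q_{n-1}} / q_n³`, for `n ≥ 1`. -/
def gam (η : ℝ) (q : ℕ → ℕ) (n : ℕ) : ℝ :=
  Real.exp (-(η * q (n - 1))) / (q n : ℝ) ^ 3

end JacobiTransport

end

/-!
The energies `λ(θ)` of a `q`-periodic Jacobi matrix solve `Δ(λ) = cos 2πθ`, where `Δ` is half the
trace of the transfer matrix over a period. Hence `λ' = -2π sin 2πθ / Δ'(λ)`, and Last's bound
follows because transfer matrices grow at most exponentially in `q`.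

By the Hellmann–Feynman formula, `Q_q(θ)` is the diagonal part, in the eigenbasis of `J(θ)`, of the
fibre of the current `i[J, X]`. Integrating the Heisenberg equation,
`(X_J(t) - X) / t` is the time average of the evolved current, in which the matrix element between
two eigenvectors is damped by `2 / (t · gap)`. The gaps of a `q_n`-periodic approximant are bounded
below by viewing the `q_{n-1}`-periodic one as `q_n`-periodic: its discriminant is then `T_r ∘ Δ`
for a Chebyshev polynomial `T_r`, whose derivative is controlled by Last's bound for the period
`q_{n-1}`, and Weyl's inequality transfers the gap. This fails only where `sin 2πθ` is small, and
there the trivial bound on a set of small measure suffices.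
-/

noncomputable section

namespace JacobiTransport

/-! ### Operators with an orthonormal eigenbasis -/

section Eigenbasis

variable {ι E : Type*} [Fintype ι] [NormedAddCommGroup E] [InnerProductSpace ℂ E]
  {A B : E →L[ℂ] E} {b c : OrthonormalBasis ι ℂ E} {α β : ι → ℝ}

lemma inner_eigenbasis_apply {α : ι → ℂ} (hA : ∀ i, A (b i) = α i • b i) (i : ι) (v : E) :
    inner ℂ (b i) (A v) = α i * inner ℂ (b i) v := by
  classical
  conv_lhs => rw [← b.sum_repr' v]
  simp [hA, orthonormal_iff_ite.mp b.orthonormal, mul_comm]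

lemma reApplyInnerSelf_eq_sum (hA : ∀ i, A (b i) = (α i : ℂ) • b i) (v : E) :
    A.reApplyInnerSelf v = ∑ i, α i * ‖inner ℂ (b i) v‖ ^ 2 := by
  rw [ContinuousLinearMap.reApplyInnerSelf_apply, ← b.sum_inner_mul_inner, map_sum]
  refine Finset.sum_congr rfl fun i _ => ?_
  have h : inner ℂ (A v) (b i) * inner ℂ (b i) v = ((α i * ‖inner ℂ (b i) v‖ ^ 2 : ℝ) : ℂ) := by
    rw [← inner_conj_symm (A v), inner_eigenbasis_apply hA, map_mul (starRingEnd ℂ),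
      Complex.conj_ofReal, mul_assoc, RCLike.conj_mul]
    push_cast
    rfl
  rw [h]
  exact Complex.ofReal_re _

lemma norm_apply_sq_le_sum (b : OrthonormalBasis ι ℂ E) (S : E →L[ℂ] E) (v : E) :
    ‖S v‖ ^ 2 ≤ (∑ i, ‖S (b i)‖ ^ 2) * ‖v‖ ^ 2 := by
  have hSv : ‖S v‖ ≤ ∑ i, ‖S (b i)‖ * ‖inner ℂ (b i) v‖ := by
    conv_lhs => rw [← b.sum_repr' v, map_sum]
    refine (norm_sum_le _ _).trans_eq (Finset.sum_congr rfl fun i _ => ?_)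
    rw [map_smul, norm_smul, mul_comm]
  calc ‖S v‖ ^ 2 ≤ (∑ i, ‖S (b i)‖ * ‖inner ℂ (b i) v‖) ^ 2 := by gcongr
    _ ≤ (∑ i, ‖S (b i)‖ ^ 2) * ∑ i, ‖inner ℂ (b i) v‖ ^ 2 :=
        Finset.sum_mul_sq_le_sq_mul_sq _ _ _
    _ = (∑ i, ‖S (b i)‖ ^ 2) * ‖v‖ ^ 2 := by rw [b.sum_sq_norm_inner_right]

lemma norm_apply_basis_sq_le {c : ℝ} {S P : E →L[ℂ] E} {j : ι}
    (hS : ∀ i, ‖inner ℂ (b i) (S (b j))‖ ≤ c * ‖inner ℂ (b i) (P (b j))‖) :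
    ‖S (b j)‖ ^ 2 ≤ c ^ 2 * ‖P‖ ^ 2 := by
  calc ‖S (b j)‖ ^ 2 = ∑ i, ‖inner ℂ (b i) (S (b j))‖ ^ 2 := (b.sum_sq_norm_inner_right _).symm
    _ ≤ ∑ i, c ^ 2 * ‖inner ℂ (b i) (P (b j))‖ ^ 2 := by
        refine Finset.sum_le_sum fun i _ => ?_
        rw [← mul_pow]
        exact pow_le_pow_left₀ (norm_nonneg _) (hS i) 2
    _ = c ^ 2 * ‖P (b j)‖ ^ 2 := by rw [← Finset.mul_sum, b.sum_sq_norm_inner_right]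
    _ ≤ c ^ 2 * ‖P‖ ^ 2 := by
        gcongr
        simpa [b.norm_eq_one] using P.le_opNorm (b j)

lemma exists_ne_zero_inner_eq_zero [LinearOrder ι] (b c : OrthonormalBasis ι ℂ E) (k : ι) :
    ∃ v ≠ 0, (∀ i, k < i → inner ℂ (b i) v = 0) ∧ ∀ i < k, inner ℂ (c i) v = 0 := by
  classical
  have hE : FiniteDimensional ℂ E := b.toBasis.finiteDimensional_of_finite
  let coords : E →ₗ[ℂ] ({i // k < i} → ℂ) × ({i // i < k} → ℂ) :=
    (LinearMap.pi fun i : {i // k < i} => innerₛₗ ℂ (b i)).prod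
      (LinearMap.pi fun i : {i // i < k} => innerₛₗ ℂ (c i))
  have hcard : Fintype.card {i // k < i} + Fintype.card {i // i < k} < Fintype.card ι := by
    rw [← Fintype.card_subtype_or_disjoint _ _
      (Pi.disjoint_iff.mpr fun i => by simpa using fun h => h.le)]
    exact Fintype.card_subtype_lt (x := k) (by simp)
  have hker : LinearMap.ker coords ≠ ⊥ := LinearMap.ker_ne_bot_of_finrank_lt (by
    simpa [Module.finrank_eq_card_basis b.toBasis] using hcard)
  obtain ⟨v, hv, hv0⟩ := Submodule.exists_mem_ne_zero_of_ne_bot hker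
  have hv' := Prod.ext_iff.mp (LinearMap.mem_ker.mp hv)
  exact ⟨v, hv0, fun i hi => congrFun hv'.1 ⟨i, hi⟩, fun i hi => congrFun hv'.2 ⟨i, hi⟩⟩

lemma eigenvalue_le_add_opNorm_sub [LinearOrder ι] (hα : Monotone α) (hβ : Monotone β)
    (hA : ∀ i, A (b i) = (α i : ℂ) • b i) (hB : ∀ i, B (c i) = (β i : ℂ) • c i) (k : ι) :
    β k ≤ α k + ‖A - B‖ := by
  obtain ⟨v, hv0, hb, hc⟩ := exists_ne_zero_inner_eq_zero b c k
  have hv : 0 < ‖v‖ ^ 2 := by positivity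
  have hAv : A.reApplyInnerSelf v ≤ α k * ‖v‖ ^ 2 := by
    rw [reApplyInnerSelf_eq_sum hA, ← b.sum_sq_norm_inner_right, Finset.mul_sum]
    refine Finset.sum_le_sum fun i _ => ?_
    rcases le_or_gt i k with hi | hi
    · exact mul_le_mul_of_nonneg_right (hα hi) (sq_nonneg _)
    · simp [hb i hi]
  have hBv : β k * ‖v‖ ^ 2 ≤ B.reApplyInnerSelf v := by
    rw [reApplyInnerSelf_eq_sum hB, ← c.sum_sq_norm_inner_right, Finset.mul_sum]
    refine Finset.sum_le_sum fun i _ => ?_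
    rcases le_or_gt k i with hi | hi
    · exact mul_le_mul_of_nonneg_right (hβ hi) (sq_nonneg _)
    · simp [hc i hi]
  have hBA : B.reApplyInnerSelf v ≤ A.reApplyInnerSelf v + ‖A - B‖ * ‖v‖ ^ 2 := by
    have h : B.reApplyInnerSelf v - A.reApplyInnerSelf v = RCLike.re (inner ℂ ((B - A) v) v) := by
      simp [ContinuousLinearMap.reApplyInnerSelf_apply]
    rw [← sub_le_iff_le_add', h, norm_sub_rev, sq, ← mul_assoc]
    exact (re_inner_le_norm _ _).trans
      (mul_le_mul_of_nonneg_right ((B - A).le_opNorm v) (norm_nonneg v))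
  refine le_of_mul_le_mul_right ?_ hv
  linarith

theorem abs_eigenvalue_sub_le_opNorm_sub [LinearOrder ι] (hα : Monotone α) (hβ : Monotone β)
    (hA : ∀ i, A (b i) = (α i : ℂ) • b i) (hB : ∀ i, B (c i) = (β i : ℂ) • c i) (k : ι) :
    |α k - β k| ≤ ‖A - B‖ := by
  have h₁ := eigenvalue_le_add_opNorm_sub hα hβ hA hB k
  have h₂ := eigenvalue_le_add_opNorm_sub hβ hα hB hA k
  rw [norm_sub_rev] at h₂
  exact abs_le.mpr ⟨by linarith, by linarith⟩

end Eigenbasis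

section HellmannFeynman

variable {ι E : Type*} [Fintype ι] [NormedAddCommGroup E] [InnerProductSpace ℂ E]
  {A : ℝ → E →L[ℂ] E} {b : ℝ → OrthonormalBasis ι ℂ E} {α : ι → ℝ → ℝ} {x : ℝ}

lemma tendsto_inner_eigenbasis (hA : ∀ y i, A y (b y i) = (α i y : ℂ) • b y i)
    (hAx : ContinuousAt A x) {j k : ι} (hα : ContinuousAt (α j) x) (hjk : α j x ≠ α k x) :
    Tendsto (fun y => inner ℂ (b y j) (b x k)) (𝓝 x) (𝓝 0) := by
  have hquot (y : ℝ) (hy : α j y ≠ α k x) : inner ℂ (b y j) (b x k) =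
      inner ℂ (b y j) ((A y - A x) (b x k)) / ((α j y - α k x : ℝ) : ℂ) := by
    rw [eq_div_iff (by exact_mod_cast sub_ne_zero.mpr hy), sub_apply, inner_sub_right,
      inner_eigenbasis_apply (hA y), hA x, inner_smul_right]
    push_cast
    ring
  have hnum : Tendsto (fun y => inner ℂ (b y j) ((A y - A x) (b x k))) (𝓝 x) (𝓝 0) := by
    refine squeeze_zero_norm (a := fun y => ‖(A y - A x) (b x k)‖) (fun y => ?_) ?_
    · exact (norm_inner_le_norm _ _).trans_eq (by rw [(b y).norm_eq_one, one_mul])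
    · have h : ContinuousAt (fun y => (A y - A x) (b x k)) x :=
        (hAx.sub continuousAt_const).clm_apply continuousAt_const
      simpa using h.norm.tendsto
  have hden : Tendsto (fun y => ((α j y - α k x : ℝ) : ℂ)) (𝓝 x)
      (𝓝 ((α j x - α k x : ℝ) : ℂ)) :=
    (Complex.continuous_ofReal.tendsto _).comp (hα.sub_const _)
  have h := hnum.div hden (by exact_mod_cast sub_ne_zero.mpr hjk)
  rw [zero_div] at h
  refine h.congr' ?_
  filter_upwards [hα.eventually_ne hjk] with y hy
  exact (hquot y hy).symm

lemma tendsto_inner_smul_eigenbasis (hA : ∀ y i, A y (b y i) = (α i y : ℂ) • b y i)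
    (hAx : ContinuousAt A x) (hα : ∀ i, ContinuousAt (α i) x) {k : ι}
    (hk : ∀ j, j ≠ k → α j x ≠ α k x) :
    Tendsto (fun y => (inner ℂ (b y k) (b x k) : ℂ) • b y k) (𝓝 x) (𝓝 (b x k)) := by
  classical
  rw [tendsto_iff_norm_sub_tendsto_zero]
  have hrest (y : ℝ) : ‖(inner ℂ (b y k) (b x k) : ℂ) • b y k - b x k‖ ≤
      ∑ j ∈ Finset.univ.erase k, ‖inner ℂ (b y j) (b x k)‖ := by
    have hsum := (b y).sum_repr' (b x k)
    rw [← Finset.add_sum_erase _ _ (Finset.mem_univ k)] at hsum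
    rw [norm_sub_rev, sub_eq_of_eq_add' hsum.symm]
    refine (norm_sum_le _ _).trans (le_of_eq (Finset.sum_congr rfl fun j _ => ?_))
    rw [norm_smul, (b y).norm_eq_one, mul_one]
  refine squeeze_zero (fun y => norm_nonneg _) hrest ?_
  rw [← Finset.sum_const_zero (s := Finset.univ.erase k)]
  refine tendsto_finsetSum _ fun j hj => ?_
  simpa using
    (tendsto_inner_eigenbasis hA hAx (hα j) (hk j (Finset.ne_of_mem_erase hj))).norm

/-- The Hellmann–Feynman formula. The eigenvectors are not assumed continuous: their phases are
arbitrary. -/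
theorem inner_hasDerivAt_eigenbasis (hA : ∀ y i, A y (b y i) = (α i y : ℂ) • b y i)
    {A' : E →L[ℂ] E} (hA' : HasDerivAt A A' x) (hα : ∀ i, ContinuousAt (α i) x) {k : ι}
    (hk : ∀ j, j ≠ k → α j x ≠ α k x) {α' : ℝ} (hα' : HasDerivAt (α k) α' x) :
    inner ℂ (b x k) (A' (b x k)) = (α' : ℂ) := by
  set w : ℝ → E := fun y => (inner ℂ (b y k) (b x k) : ℂ) • b y k with hw
  have hw_tendsto : Tendsto w (𝓝[≠] x) (𝓝 (b x k)) :=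
    (tendsto_inner_smul_eigenbasis hA hA'.continuousAt hα hk).mono_left nhdsWithin_le_nhds
  have hslope (y : ℝ) : inner ℂ (w y) (slope A x y (b x k)) =
      (slope (α k) x y : ℂ) * inner ℂ (w y) (b x k) := by
    have hdiff : inner ℂ (b y k) ((A y - A x) (b x k)) =
        ((α k y - α k x : ℝ) : ℂ) * inner ℂ (b y k) (b x k) := by
      rw [sub_apply, inner_sub_right, inner_eigenbasis_apply (hA y), hA x, inner_smul_right]
      push_cast
      ring
    rw [slope_def_module, slope_def_module, FunLike.coe_smul, Pi.smul_apply, ← Complex.coe_smul,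
      inner_smul_right, hw, inner_smul_left, inner_smul_left, hdiff, smul_eq_mul]
    push_cast
    ring
  have hlim : Tendsto (fun y => inner ℂ (w y) (slope A x y (b x k))) (𝓝[≠] x)
      (𝓝 (inner ℂ (b x k) (A' (b x k)))) :=
    hw_tendsto.inner (((ContinuousLinearMap.apply ℂ E (b x k)).continuous.tendsto A').comp
      (hasDerivAt_iff_tendsto_slope.mp hA'))
  have hlim' : Tendsto (fun y => (slope (α k) x y : ℂ) * inner ℂ (w y) (b x k)) (𝓝[≠] x)
      (𝓝 (α' * inner ℂ (b x k) (b x k))) :=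
    ((Complex.continuous_ofReal.tendsto α').comp (hasDerivAt_iff_tendsto_slope.mp hα')).mul
      (hw_tendsto.inner tendsto_const_nhds)
  simp only [hslope] at hlim
  simpa using tendsto_nhds_unique hlim hlim'

end HellmannFeynman

/-! ### Heisenberg averages -/

section Heisenberg

variable {𝔸 𝔹 : Type*} [NormedRing 𝔸] [NormedAlgebra ℂ 𝔸] [NormedRing 𝔹] [NormedAlgebra ℂ 𝔹]

/-- The one-parameter group `s ↦ e^{isA}` generated by an element of a Banach algebra. -/
def expI (A : 𝔸) (s : ℝ) : 𝔸 := NormedSpace.exp ((Complex.I * (s : ℂ)) • A)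

lemma expI_zero (A : 𝔸) : expI A 0 = 1 := by simp [expI]

lemma hasDerivAt_expI [CompleteSpace 𝔸] (A : 𝔸) (s : ℝ) :
    HasDerivAt (expI A) (Complex.I • (A * expI A s)) s := by
  have h := hasDerivAt_exp_smul_const' (𝕂 := ℝ) (Complex.I • A) s
  have e : ∀ u : ℝ, u • (Complex.I • A) = (Complex.I * (u : ℂ)) • A := by
    intro u
    rw [← Complex.coe_smul u, smul_smul, mul_comm]
  simp only [e] at h
  rwa [smul_mul_assoc] at h

lemma commute_expI (A : 𝔸) (s : ℝ) : Commute A (expI A s) := by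
  let := NormedAlgebra.restrictScalars ℚ ℂ 𝔸
  exact ((Commute.refl A).smul_right _).exp_right

lemma continuous_expI [CompleteSpace 𝔸] (A : 𝔸) : Continuous (expI A) :=
  continuous_iff_continuousAt.mpr fun s => (hasDerivAt_expI A s).continuousAt

lemma map_expI [CompleteSpace 𝔸] (φ : 𝔸 →A[ℂ] 𝔹) (A : 𝔸) (s : ℝ) : φ (expI A s) = expI (φ A) s := by
  let := NormedAlgebra.restrictScalars ℚ ℂ 𝔸
  let := NormedAlgebra.restrictScalars ℚ ℂ 𝔹
  rw [expI, NormedSpace.map_exp φ φ.continuous, map_smul, expI]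

/-- The Heisenberg evolution `e^{isA} P e^{-isA}` of `P` under `A`. -/
def heis (A P : 𝔸) (s : ℝ) : 𝔸 := expI A s * P * expI A (-s)

lemma continuous_heis [CompleteSpace 𝔸] (A P : 𝔸) : Continuous (heis A P) :=
  ((continuous_expI A).mul continuous_const).mul ((continuous_expI A).comp continuous_neg)

/-- The time average `t⁻¹ ∫₀ᵗ e^{isA} P e^{-isA} ds` of the Heisenberg evolution. -/
def heisAvg (A P : 𝔸) (t : ℝ) : 𝔸 := ((1 / t : ℝ) : ℂ) • ∫ s in (0 : ℝ)..t, heis A P s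

lemma map_heis [CompleteSpace 𝔸] (φ : 𝔸 →A[ℂ] 𝔹) (A P : 𝔸) (s : ℝ) :
    φ (heis A P s) = heis (φ A) (φ P) s := by
  rw [heis, map_mul, map_mul, map_expI, map_expI, heis]

lemma map_heisAvg [CompleteSpace 𝔸] [CompleteSpace 𝔹] (φ : 𝔸 →A[ℂ] 𝔹) (A P : 𝔸) (t : ℝ) :
    φ (heisAvg A P t) = heisAvg (φ A) (φ P) t := by
  rw [heisAvg, map_smul, heisAvg]
  congr 1
  let L : 𝔸 →L[ℂ] 𝔹 := ⟨φ.toAlgHom.toLinearMap, φ.continuous⟩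
  have h := L.intervalIntegral_comp_comm
    ((continuous_heis A P).intervalIntegrable (μ := volume) 0 t)
  simp_rw [← map_heis φ]
  exact h.symm

lemma norm_heisAvg_le {A P : 𝔸} {C : ℝ} (hC : ∀ s, ‖heis A P s‖ ≤ C) {t : ℝ} (ht : 0 < t) :
    ‖heisAvg A P t‖ ≤ C := by
  have h := intervalIntegral.norm_integral_le_of_norm_le_const (a := 0) (b := t)
    fun s _ => hC s
  rw [heisAvg, norm_smul, Complex.norm_real, Real.norm_eq_abs, abs_of_pos (by positivity)]
  rw [sub_zero, abs_of_pos ht] at h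
  rw [one_div, inv_mul_le_iff₀ ht]
  linarith

end Heisenberg

section EigenbasisAverage

variable {ι E : Type*} [NormedAddCommGroup E] [InnerProductSpace ℂ E] [CompleteSpace E]
  {A P : E →L[ℂ] E}

lemma exp_apply_eigenvector {v : E} {μ : ℂ} (hv : A v = μ • v) :
    NormedSpace.exp A v = Complex.exp μ • v := by
  have hpow (n : ℕ) : (A ^ n) v = μ ^ n • v := by
    induction n with
    | zero => simp
    | succ n ih => rw [pow_succ, mul_apply_eq_comp, hv, map_smul, ih, smul_smul, pow_succ']
  have hA := (ContinuousLinearMap.apply ℂ E v).hasSum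
    (NormedSpace.exp_series_hasSum_exp' (𝕂 := ℂ) A)
  have hμ := (NormedSpace.exp_series_hasSum_exp' (𝕂 := ℂ) μ).smul_const v
  rw [← Complex.exp_eq_exp_ℂ] at hμ
  refine hA.unique (hμ.congr_fun fun n => ?_)
  simp [hpow, smul_smul]

lemma expI_apply_eigenvector {v : E} {μ : ℝ} (hv : A v = (μ : ℂ) • v) (s : ℝ) :
    expI A s v = Complex.exp (Complex.I * μ * s) • v := by
  refine exp_apply_eigenvector ?_
  rw [FunLike.coe_smul, Pi.smul_apply, hv, smul_smul, mul_right_comm]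

variable [Fintype ι] {b : OrthonormalBasis ι ℂ E} {α : ι → ℝ}

lemma norm_expI_apply (hA : ∀ i, A (b i) = (α i : ℂ) • b i) (s : ℝ) (v : E) :
    ‖expI A s v‖ = ‖v‖ := by
  rw [← sq_eq_sq₀ (norm_nonneg _) (norm_nonneg _), ← b.sum_sq_norm_inner_right,
    ← b.sum_sq_norm_inner_right v]
  refine Finset.sum_congr rfl fun i _ => ?_
  rw [inner_eigenbasis_apply fun i => expI_apply_eigenvector (hA i) s, norm_mul, mul_assoc,
    ← Complex.ofReal_mul, mul_comm, Complex.norm_exp_I_mul_ofReal, mul_one]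

lemma norm_heis_le (hA : ∀ i, A (b i) = (α i : ℂ) • b i) (s : ℝ) : ‖heis A P s‖ ≤ ‖P‖ := by
  refine ContinuousLinearMap.opNorm_le_bound _ (norm_nonneg _) fun v => ?_
  rw [heis, mul_apply_eq_comp, mul_apply_eq_comp, norm_expI_apply hA, ← norm_expI_apply hA (-s) v]
  exact P.le_opNorm _

lemma inner_heis (hA : ∀ i, A (b i) = (α i : ℂ) • b i) (i j : ι) (s : ℝ) :
    inner ℂ (b i) (heis A P s (b j)) =
      Complex.exp (Complex.I * (α i - α j : ℝ) * s) * inner ℂ (b i) (P (b j)) := by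
  rw [heis, mul_apply_eq_comp, mul_apply_eq_comp,
    inner_eigenbasis_apply fun i => expI_apply_eigenvector (hA i) s,
    expI_apply_eigenvector (hA j), map_smul, inner_smul_right, ← mul_assoc, ← Complex.exp_add]
  congr 2
  push_cast
  ring

lemma inner_heisAvg (hA : ∀ i, A (b i) = (α i : ℂ) • b i) (i j : ι) (t : ℝ) :
    inner ℂ (b i) (heisAvg A P t (b j)) =
      ((1 / t : ℝ) : ℂ) * (∫ s in (0 : ℝ)..t, Complex.exp (Complex.I * (α i - α j : ℝ) * s)) *
        inner ℂ (b i) (P (b j)) := by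
  let entry : (E →L[ℂ] E) →L[ℂ] ℂ := innerSL ℂ (b i) ∘L ContinuousLinearMap.apply ℂ E (b j)
  have h := entry.intervalIntegral_comp_comm
    ((continuous_heis A P).intervalIntegrable (μ := volume) 0 t)
  change entry (heisAvg A P t) = _
  rw [heisAvg, map_smul, smul_eq_mul, ← h, mul_assoc, ← intervalIntegral.integral_mul_const]
  congr 1
  exact intervalIntegral.integral_congr fun s _ => inner_heis hA i j s

lemma norm_integral_exp_le {ω : ℝ} (hω : ω ≠ 0) (t : ℝ) :
    ‖∫ s in (0 : ℝ)..t, Complex.exp (Complex.I * ω * s)‖ ≤ 2 / |ω| := by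
  have hω' : Complex.I * (ω : ℂ) ≠ 0 :=
    mul_ne_zero Complex.I_ne_zero (Complex.ofReal_ne_zero.mpr hω)
  rw [integral_exp_mul_complex hω', norm_div, norm_mul, Complex.norm_I, one_mul, Complex.norm_real,
    Real.norm_eq_abs]
  gcongr
  refine (norm_sub_le _ _).trans_eq ?_
  rw [mul_assoc, mul_assoc, ← Complex.ofReal_mul, ← Complex.ofReal_mul,
    Complex.norm_exp_I_mul_ofReal, Complex.norm_exp_I_mul_ofReal, one_add_one_eq_two]

lemma norm_inner_sub_heisAvg_le (hA : ∀ i, A (b i) = (α i : ℂ) • b i) {Q : E →L[ℂ] E}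
    (hQ : ∀ i, Q (b i) = (inner ℂ (b i) (P (b i)) : ℂ) • b i) {ε t : ℝ} (hε : 0 < ε) (ht : 0 < t)
    (hgap : Pairwise fun i j => ε ≤ |α i - α j|) (i j : ι) :
    ‖inner ℂ (b i) ((Q - heisAvg A P t) (b j))‖ ≤ 2 / (t * ε) * ‖inner ℂ (b i) (P (b j))‖ := by
  rw [sub_apply, inner_sub_right, inner_heisAvg hA, hQ, inner_smul_right]
  rcases eq_or_ne i j with rfl | hij
  · have ht' : (t : ℂ) ≠ 0 := Complex.ofReal_ne_zero.mpr ht.ne'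
    have hdiag : inner ℂ (b i) (P (b i)) * inner ℂ (b i) (b i) = ((1 / t : ℝ) : ℂ) *
        (∫ s in (0 : ℝ)..t, Complex.exp (Complex.I * (α i - α i : ℝ) * s)) *
          inner ℂ (b i) (P (b i)) := by
      simp [ht']
    rw [hdiag, sub_self, norm_zero]
    positivity
  · have hω : ε ≤ |α i - α j| := hgap hij
    rw [b.orthonormal.inner_eq_zero hij, mul_zero, zero_sub, norm_neg, norm_mul, norm_mul,
      Complex.norm_real, Real.norm_of_nonneg (by positivity)]
    gcongr
    calc 1 / t * ‖∫ s in (0 : ℝ)..t, Complex.exp (Complex.I * (α i - α j : ℝ) * s)‖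
        ≤ 1 / t * (2 / |α i - α j|) := by
          gcongr
          exact norm_integral_exp_le (abs_pos.mp (hε.trans_le hω)) t
      _ ≤ 1 / t * (2 / ε) := by gcongr
      _ = 2 / (t * ε) := by field_simp

/-- Here `Q` is the diagonal part of `P` in the eigenbasis. Averaging the phase
`e^{is(αᵢ - αⱼ)}` suppresses the off-diagonal entries by `2 / (t |αᵢ - αⱼ|)`. -/
theorem norm_sub_heisAvg_apply_sq_le (hA : ∀ i, A (b i) = (α i : ℂ) • b i) {Q : E →L[ℂ] E}
    (hQ : ∀ i, Q (b i) = (inner ℂ (b i) (P (b i)) : ℂ) • b i) {ε t : ℝ} (hε : 0 < ε) (ht : 0 < t)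
    (hgap : Pairwise fun i j => ε ≤ |α i - α j|) (v : E) :
    ‖(Q - heisAvg A P t) v‖ ^ 2 ≤ (2 / (t * ε)) ^ 2 * (Fintype.card ι * ‖P‖ ^ 2) * ‖v‖ ^ 2 := by
  refine (norm_apply_sq_le_sum b _ v).trans (mul_le_mul_of_nonneg_right ?_ (sq_nonneg _))
  calc ∑ j, ‖(Q - heisAvg A P t) (b j)‖ ^ 2
      ≤ ∑ _j : ι, (2 / (t * ε)) ^ 2 * ‖P‖ ^ 2 := Finset.sum_le_sum fun j _ =>
        norm_apply_basis_sq_le fun i => norm_inner_sub_heisAvg_le hA hQ hε ht hgap i j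
    _ = (2 / (t * ε)) ^ 2 * (Fintype.card ι * ‖P‖ ^ 2) := by
        rw [Finset.sum_const, nsmul_eq_mul, Finset.card_univ, mul_left_comm]

end EigenbasisAverage

/-! ### The Floquet vectors in the fibre -/

/-- The value at the quasimomentum `θ` of the Floquet transform of the basis vector `δ_n`. -/
def fibreVec (q : ℕ) [NeZero q] (n : ℤ) (θ : UnitAddCircle) : Fibre q :=
  fourier (-(Int.divModEquiv q n).1) θ •
    (EuclideanSpace.single (Int.divModEquiv q n).2 (1 : ℂ) : Fibre q)

section FibreVec

variable (q : ℕ) [NeZero q]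

lemma divModEquiv_add_mul (k : Fin q) (p : ℤ) :
    Int.divModEquiv q ((k : ℤ) + p * q) = (p, k) := by
  rw [← Equiv.eq_symm_apply, Int.divModEquiv_symm_apply]
  ring

lemma eq_add_mul_of_divModEquiv (n : ℤ) :
    n = ((Int.divModEquiv q n).2 : ℤ) + (Int.divModEquiv q n).1 * q := by
  conv_lhs => rw [← (Int.divModEquiv q).symm_apply_apply n]
  rw [Int.divModEquiv_symm_apply]
  ring

lemma divModEquiv_natCast (k : Fin q) : Int.divModEquiv q (k : ℤ) = (0, k) := by
  simpa using divModEquiv_add_mul q k 0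

lemma exists_eq_natCast_add_mul (n : ℤ) : ∃ (p : ℤ) (k : Fin q), n = (k : ℤ) + p * q :=
  ⟨_, _, eq_add_mul_of_divModEquiv q n⟩

lemma fibreVec_natCast_add_mul (k : Fin q) (p : ℤ) (θ : UnitAddCircle) :
    fibreVec q ((k : ℤ) + p * q) θ =
      fourier (-p) θ • (EuclideanSpace.single k (1 : ℂ) : Fibre q) := by
  rw [fibreVec, divModEquiv_add_mul]

lemma fibreVec_natCast (k : Fin q) (θ : UnitAddCircle) :
    fibreVec q (k : ℤ) θ = (EuclideanSpace.single k (1 : ℂ) : Fibre q) := by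
  simpa using fibreVec_natCast_add_mul q k 0 θ

lemma fibreVec_add_mul (n p : ℤ) (θ : UnitAddCircle) :
    fibreVec q (n + p * q) θ = fourier (-p) θ • fibreVec q n θ := by
  obtain ⟨l, k, rfl⟩ := exists_eq_natCast_add_mul q n
  rw [show (k : ℤ) + l * q + p * q = k + (l + p) * q by ring, fibreVec_natCast_add_mul,
    fibreVec_natCast_add_mul, smul_smul, ← fourier_add, neg_add_rev]

lemma norm_fibreVec (n : ℤ) (θ : UnitAddCircle) : ‖fibreVec q n θ‖ = 1 := by
  rw [fibreVec, norm_smul, PiLp.norm_single, norm_one, mul_one, fourier_apply, Circle.norm_coe]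

lemma inner_fibreVec (m n : ℤ) (θ : UnitAddCircle) :
    inner ℂ (fibreVec q m θ) (fibreVec q n θ) =
      if (q : ℤ) ∣ n - m then fourier (-((n - m) / q)) θ else 0 := by
  split_ifs with h
  · obtain ⟨p, hp⟩ := h
    obtain rfl : n = m + p * q := by linear_combination hp
    rw [fibreVec_add_mul, inner_smul_right, inner_self_eq_norm_sq_to_K, norm_fibreVec, hp,
      Int.mul_ediv_cancel_left p (by exact_mod_cast NeZero.ne q)]
    simp
  · obtain ⟨p, k, rfl⟩ := exists_eq_natCast_add_mul q m
    obtain ⟨r, l, rfl⟩ := exists_eq_natCast_add_mul q n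
    have hkl : k ≠ l := by
      rintro rfl
      exact h ⟨r - p, by ring⟩
    rw [fibreVec_natCast_add_mul, fibreVec_natCast_add_mul, inner_smul_left, inner_smul_right,
      EuclideanSpace.inner_single_left]
    simp [hkl]

lemma orthonormal_fibreVec_add (s : ℤ) (θ : UnitAddCircle) :
    Orthonormal ℂ (fun k : Fin q => fibreVec q (k + s) θ) := by
  refine ⟨fun k => norm_fibreVec q _ θ, fun k l hkl => ?_⟩
  refine (inner_fibreVec q _ _ θ).trans (if_neg fun hdvd => hkl ?_)
  have hk := k.2
  have hl := l.2
  have hzero := Int.eq_zero_of_abs_lt_dvd hdvd (abs_lt.mpr ⟨by omega, by omega⟩)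
  omega

lemma fibreVec_apply (n : ℤ) (j : Fin q) (θ : UnitAddCircle) :
    fibreVec q n θ j = inner ℂ (fibreVec q j θ) (fibreVec q n θ) := by
  rw [fibreVec_natCast, EuclideanSpace.inner_single_left]
  simp

lemma continuous_fibreVec (n : ℤ) : Continuous (fibreVec q n) := by
  unfold fibreVec
  fun_prop

lemma fourier_coe_unit (n : ℤ) (x : ℝ) :
    fourier n (x : UnitAddCircle) = Complex.exp (2 * π * Complex.I * n * x) := by
  rw [fourier_coe_apply]
  simp

lemma hasDerivAt_fibreVec (n : ℤ) (x : ℝ) :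
    HasDerivAt (fun y : ℝ => fibreVec q n (y : UnitAddCircle))
      ((-(2 * π * Complex.I * (Int.divModEquiv q n).1)) • fibreVec q n (x : UnitAddCircle)) x := by
  have h := (hasDerivAt_fourier (1 : ℝ) (-(Int.divModEquiv q n).1) x).smul_const
    (EuclideanSpace.single (Int.divModEquiv q n).2 (1 : ℂ) : Fibre q)
  have hcoeff :
      (-(2 * π * Complex.I * (Int.divModEquiv q n).1)) • fibreVec q n (x : UnitAddCircle) =
      (2 * π * Complex.I * ((-(Int.divModEquiv q n).1 : ℤ) : ℂ) / (1 : ℝ) *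
        fourier (-(Int.divModEquiv q n).1) (x : AddCircle (1 : ℝ))) •
      (EuclideanSpace.single (Int.divModEquiv q n).2 (1 : ℂ) : Fibre q) := by
    rw [fibreVec, smul_smul]
    congr 1
    push_cast
    ring
  rwa [hcoeff]

lemma fibreVec_natCast_add_one_apply (k j : Fin q) (x : ℝ) :
    fibreVec q (k + 1) (x : UnitAddCircle) j =
      (if (k : ℕ) + 1 = j then 1 else 0) + (if (k : ℕ) + 1 = q ∧ (j : ℕ) = 0 then
        Complex.exp (-(2 * π * x * Complex.I)) else 0) := by
  have hj := j.2
  rw [fibreVec_apply, inner_fibreVec]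
  by_cases hsucc : (k : ℕ) + 1 = j
  · have hzero : (k : ℤ) + 1 - j = 0 := by omega
    rw [if_pos hsucc, if_neg (by omega : ¬((k : ℕ) + 1 = q ∧ (j : ℕ) = 0)), hzero]
    simp
  by_cases hwrap : (k : ℕ) + 1 = q ∧ (j : ℕ) = 0
  · have hq : (k : ℤ) + 1 - j = q := by omega
    have hexp : 2 * π * Complex.I * ((-1 : ℤ) : ℂ) * x = -(2 * π * x * Complex.I) := by
      push_cast
      ring
    rw [if_neg hsucc, if_pos hwrap, hq, if_pos dvd_rfl,
      Int.ediv_self (by exact_mod_cast NeZero.ne q), fourier_coe_unit, hexp, zero_add]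
  · rw [if_neg hsucc, if_neg hwrap, add_zero, if_neg]
    intro hdvd
    have hzero := Int.eq_zero_of_abs_lt_dvd hdvd (abs_lt.mpr ⟨by omega, by omega⟩)
    omega

lemma fibreVec_natCast_sub_one_apply (k j : Fin q) (x : ℝ) :
    fibreVec q (k - 1) (x : UnitAddCircle) j =
      (if (j : ℕ) + 1 = k then 1 else 0) + (if (j : ℕ) + 1 = q ∧ (k : ℕ) = 0 then
        Complex.exp (2 * π * x * Complex.I) else 0) := by
  have hconj : fibreVec q (k - 1) (x : UnitAddCircle) j =
      starRingEnd ℂ (fibreVec q (j + 1) (x : UnitAddCircle) k) := by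
    have hshift : (j : ℤ) - (k - 1) = j + 1 - k := by ring
    rw [fibreVec_apply, fibreVec_apply, ← inner_conj_symm, inner_fibreVec, inner_fibreVec, hshift]
  rw [hconj, fibreVec_natCast_add_one_apply]
  simp [apply_ite (starRingEnd ℂ), ← Complex.exp_conj, Complex.conj_ofNat]

/-! ### Tridiagonal fibre operators -/

/-- The fibres of the `q`-periodic operator `δ_n ↦ α_n δ_{n+1} + β_n δ_n + γ_n δ_{n-1}`; only the
coefficients of the period cell `0 ≤ n < q` enter. -/
def triFibre (α β γ : ℤ → ℂ) : C(UnitAddCircle, Fibre q →L[ℂ] Fibre q) where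
  toFun θ := ∑ k : Fin q, (innerSL ℂ (EuclideanSpace.single k (1 : ℂ) : Fibre q)).smulRight
    (α k • fibreVec q (k + 1) θ + β k • fibreVec q k θ + γ k • fibreVec q (k - 1) θ)
  continuous_toFun := by
    refine continuous_finsetSum _ fun k _ => ?_
    have h : Continuous fun v : Fibre q =>
        (innerSL ℂ (EuclideanSpace.single k (1 : ℂ) : Fibre q)).smulRight v :=
      ((ContinuousLinearMap.smulRightL ℂ (Fibre q) (Fibre q))
        (innerSL ℂ (EuclideanSpace.single k (1 : ℂ) : Fibre q))).continuous
    refine h.comp ?_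
    have := continuous_fibreVec q
    fun_prop

lemma triFibre_apply (α β γ : ℤ → ℂ) (θ : UnitAddCircle) (v : Fibre q) :
    triFibre q α β γ θ v = ∑ k : Fin q, v k •
      (α k • fibreVec q (k + 1) θ + β k • fibreVec q k θ + γ k • fibreVec q (k - 1) θ) := by
  simp [triFibre, EuclideanSpace.inner_single_left]

lemma triFibre_single (α β γ : ℤ → ℂ) (θ : UnitAddCircle) (k : Fin q) :
    triFibre q α β γ θ (EuclideanSpace.single k (1 : ℂ)) =
      α k • fibreVec q (k + 1) θ + β k • fibreVec q k θ + γ k • fibreVec q (k - 1) θ := by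
  rw [triFibre_apply, Finset.sum_eq_single k]
  · simp
  · intro b _ hb
    simp [hb]
  · simp

lemma triFibre_fibreVec {α β γ : ℤ → ℂ} (hα : Function.Periodic α q) (hβ : Function.Periodic β q)
    (hγ : Function.Periodic γ q) (θ : UnitAddCircle) (n : ℤ) :
    triFibre q α β γ θ (fibreVec q n θ) =
      α n • fibreVec q (n + 1) θ + β n • fibreVec q n θ + γ n • fibreVec q (n - 1) θ := by
  obtain ⟨p, k, rfl⟩ := exists_eq_natCast_add_mul q n
  have hper {f : ℤ → ℂ} (hf : Function.Periodic f q) : f (k + p * q) = f k := by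
    simpa using hf.int_mul p k
  rw [fibreVec_natCast_add_mul, map_smul, triFibre_single, hper hα, hper hβ, hper hγ,
    add_right_comm (k : ℤ), add_sub_right_comm, fibreVec_add_mul, fibreVec_add_mul,
    ← fibreVec_natCast q k θ]
  module

/-- The value at `θ` of the derivative of `triFibre` along the circle. -/
def triFibreDeriv (α γ : ℤ → ℂ) : C(UnitAddCircle, Fibre q →L[ℂ] Fibre q) :=
  triFibre q (fun n => α n * -(2 * π * Complex.I * (Int.divModEquiv q (n + 1)).1)) 0
    (fun n => γ n * -(2 * π * Complex.I * (Int.divModEquiv q (n - 1)).1))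

lemma hasDerivAt_triFibre (α β γ : ℤ → ℂ) (x : ℝ) :
    HasDerivAt (fun y : ℝ => triFibre q α β γ (y : UnitAddCircle))
      (triFibreDeriv q α γ (x : UnitAddCircle)) x := by
  change HasDerivAt (fun y : ℝ => ∑ k : Fin q,
    (innerSL ℂ (EuclideanSpace.single k (1 : ℂ) : Fibre q)).smulRight
      (α k • fibreVec q (k + 1) (y : UnitAddCircle) + β k • fibreVec q k (y : UnitAddCircle) +
        γ k • fibreVec q (k - 1) (y : UnitAddCircle))) (∑ k : Fin q, _) x
  refine HasDerivAt.fun_sum fun k _ => ?_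
  have hvec := (((hasDerivAt_fibreVec q (k + 1) x).const_smul (α k)).add
    ((hasDerivAt_fibreVec q k x).const_smul (β k))).add
    ((hasDerivAt_fibreVec q (k - 1) x).const_smul (γ k))
  rw [divModEquiv_natCast] at hvec
  simp only [smul_smul, Int.cast_zero, mul_zero, neg_zero] at hvec
  exact (((ContinuousLinearMap.smulRightL ℂ (Fibre q) (Fibre q))
    (innerSL ℂ (EuclideanSpace.single k (1 : ℂ) : Fibre q))).restrictScalars
      ℝ).hasFDerivAt.comp_hasDerivAt x hvec

lemma norm_sum_smul_fibreVec_le {α : ℤ → ℂ} {C : ℝ} (hα : ∀ n, ‖α n‖ ≤ C) (s : ℤ)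
    (θ : UnitAddCircle) (v : Fibre q) :
    ‖∑ k : Fin q, v k • α k • fibreVec q (k + s) θ‖ ≤ C * ‖v‖ := by
  have hC : 0 ≤ C := (norm_nonneg _).trans (hα 0)
  have hparseval : ‖∑ k : Fin q, v k • α k • fibreVec q (k + s) θ‖ ^ 2 =
      ∑ k : Fin q, ‖v k * α k‖ ^ 2 := by
    have h := (orthonormal_fibreVec_add q s θ).inner_sum (fun k => v k * α k)
      (fun k => v k * α k) Finset.univ
    rw [inner_self_eq_norm_sq_to_K] at h
    simp_rw [RCLike.conj_mul, ← smul_smul] at h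
    exact_mod_cast h
  refine le_of_sq_le_sq ?_ (by positivity)
  rw [hparseval, mul_pow, EuclideanSpace.norm_sq_eq, Finset.mul_sum]
  refine Finset.sum_le_sum fun k _ => ?_
  rw [norm_mul, mul_pow, mul_comm]
  gcongr
  exact hα k

lemma norm_triFibre_le {α β γ : ℤ → ℂ} {A B C : ℝ} (hα : ∀ n, ‖α n‖ ≤ A)
    (hβ : ∀ n, ‖β n‖ ≤ B) (hγ : ∀ n, ‖γ n‖ ≤ C) (θ : UnitAddCircle) :
    ‖triFibre q α β γ θ‖ ≤ A + B + C := by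
  have hA : 0 ≤ A := (norm_nonneg _).trans (hα 0)
  have hB : 0 ≤ B := (norm_nonneg _).trans (hβ 0)
  have hC : 0 ≤ C := (norm_nonneg _).trans (hγ 0)
  refine ContinuousLinearMap.opNorm_le_bound _ (by positivity) fun v => ?_
  have h0 := norm_sum_smul_fibreVec_le q hβ 0 θ v
  have h1 := norm_sum_smul_fibreVec_le q hα 1 θ v
  have h2 := norm_sum_smul_fibreVec_le q hγ (-1) θ v
  simp only [add_zero, ← sub_eq_add_neg] at h0 h2
  simp only [triFibre_apply, smul_add, Finset.sum_add_distrib, add_mul]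
  exact norm_add₃_le.trans (add_le_add (add_le_add h1 h0) h2)

end FibreVec

/-! ### The Floquet matrix as a tridiagonal fibre operator -/

lemma floquetEig_monotone (q : ℕ) (J : JacobiMatrix) (x : ℝ) :
    Monotone fun k : Fin q => floquetEig q J k x := by
  intro k l hkl
  apply (floquetMatrix_isHermitian q J x).eigenvalues₀_antitone
  simpa using hkl

/-- The orthonormal basis of eigenvectors of the Floquet matrix, ordered as the eigenvalues
`floquetEig`. -/
def floquetEigenbasis (q : ℕ) (J : JacobiMatrix) (x : ℝ) :
    OrthonormalBasis (Fin q) ℂ (Fibre q) :=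
  (floquetMatrix_isHermitian q J x).eigenvectorBasis.reindex
    ((Fin.revPerm.trans (finCongr (Fintype.card_fin q).symm)).trans
      (Fintype.equivOfCardEq (Fintype.card_fin _))).symm

section JacobiFibre

variable (q : ℕ) [NeZero q] (J : JacobiMatrix)

/-- The fibres of the Jacobi matrix `J`: the Floquet matrix as a continuous function on the
circle. -/
def jacobiFibre : C(UnitAddCircle, Fibre q →L[ℂ] Fibre q) :=
  triFibre q (fun n => J.a n) (fun n => J.b n) (fun n => J.a (n - 1))

/-- The fibres of the current operator `i[J, X]`. -/
def currentFibre : C(UnitAddCircle, Fibre q →L[ℂ] Fibre q) :=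
  triFibre q (fun n => -(Complex.I * J.a n)) 0 (fun n => Complex.I * J.a (n - 1))

/-- Multiplication by the index in the period cell. -/
def indexOp : Fibre q →L[ℂ] Fibre q :=
  ∑ k : Fin q, (innerSL ℂ (EuclideanSpace.single k (1 : ℂ) : Fibre q)).smulRight
    ((k : ℂ) • (EuclideanSpace.single k (1 : ℂ) : Fibre q))

lemma indexOp_single (k : Fin q) : indexOp q (EuclideanSpace.single k (1 : ℂ)) =
    (k : ℂ) • (EuclideanSpace.single k (1 : ℂ) : Fibre q) := by
  rw [indexOp, sum_apply, Finset.sum_eq_single k]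
  · simp
  · intro l _ hl
    simp [EuclideanSpace.inner_single_left, hl]
  · simp

lemma indexOp_fibreVec (n : ℤ) (θ : UnitAddCircle) :
    indexOp q (fibreVec q n θ) = ((Int.divModEquiv q n).2 : ℂ) • fibreVec q n θ := by
  rw [fibreVec, map_smul, indexOp_single, smul_comm]

/-- With `X = q ⌊X/q⌋ + (X mod q)`, the first part contributes the derivative in the quasimomentum
to the current and the second one a commutator. -/
theorem currentFibre_eq_deriv_add_commutator (θ : UnitAddCircle) :
    currentFibre q J θ = ((q : ℂ) / (2 * π)) •
        triFibreDeriv q (fun n => J.a n) (fun n => J.a (n - 1)) θ +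
      Complex.I • (jacobiFibre q J θ ∘L indexOp q - indexOp q ∘L jacobiFibre q J θ) := by
  refine ContinuousLinearMap.coe_injective
    ((EuclideanSpace.basisFun (Fin q) ℂ).toBasis.ext fun k => ?_)
  have hpi : (π : ℂ) ≠ 0 := Complex.ofReal_ne_zero.mpr Real.pi_ne_zero
  have hindex (m : ℤ) :
      ((Int.divModEquiv q m).2 : ℂ) = m - (Int.divModEquiv q m).1 * q := by
    rw [eq_sub_iff_add_eq]
    exact_mod_cast (eq_add_mul_of_divModEquiv q m).symm
  simp only [OrthonormalBasis.coe_toBasis, EuclideanSpace.basisFun_apply,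
    ContinuousLinearMap.coe_coe, add_apply, FunLike.coe_smul, Pi.smul_apply, FunLike.coe_sub,
    Pi.sub_apply, ContinuousLinearMap.comp_apply, currentFibre, jacobiFibre, triFibreDeriv,
    triFibre_single, indexOp_single, indexOp_fibreVec, map_smul, map_add, hindex, Pi.zero_apply,
    divModEquiv_natCast]
  push_cast
  match_scalars <;> field_simp <;> ring

variable {J}

lemma JacobiMatrix.IsPeriodic.periodic_a {q : ℕ} (hJ : J.IsPeriodic q) :
    Function.Periodic J.a (q : ℤ) := fun n => (hJ n).1

lemma JacobiMatrix.IsPeriodic.periodic_b {q : ℕ} (hJ : J.IsPeriodic q) :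
    Function.Periodic J.b (q : ℤ) := fun n => (hJ n).2

lemma JacobiMatrix.IsPeriodic.periodic_comp_a {q : ℕ} (hJ : J.IsPeriodic q) (f : ℝ → ℂ) :
    Function.Periodic (fun n => f (J.a n)) (q : ℤ) := hJ.periodic_a.comp f

lemma JacobiMatrix.IsPeriodic.periodic_comp_a_sub_one {q : ℕ} (hJ : J.IsPeriodic q)
    (f : ℝ → ℂ) : Function.Periodic (fun n => f (J.a (n - 1))) (q : ℤ) :=
  (hJ.periodic_comp_a f).sub_const 1

lemma jacobiFibre_fibreVec (hJ : J.IsPeriodic q) (θ : UnitAddCircle) (n : ℤ) :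
    jacobiFibre q J θ (fibreVec q n θ) = (J.a n : ℂ) • fibreVec q (n + 1) θ +
      (J.b n : ℂ) • fibreVec q n θ + (J.a (n - 1) : ℂ) • fibreVec q (n - 1) θ :=
  triFibre_fibreVec q (hJ.periodic_comp_a fun y => (y : ℂ))
    (hJ.periodic_b.comp fun y : ℝ => (y : ℂ))
    (hJ.periodic_comp_a_sub_one fun y => (y : ℂ)) θ n

lemma currentFibre_fibreVec (hJ : J.IsPeriodic q) (θ : UnitAddCircle) (n : ℤ) :
    currentFibre q J θ (fibreVec q n θ) = (-(Complex.I * J.a n)) • fibreVec q (n + 1) θ +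
      (Complex.I * J.a (n - 1)) • fibreVec q (n - 1) θ := by
  rw [currentFibre, triFibre_fibreVec q (hJ.periodic_comp_a fun y => -(Complex.I * y))
    (fun _ => rfl) (hJ.periodic_comp_a_sub_one fun y => Complex.I * y), Pi.zero_apply, zero_smul,
    add_zero]

lemma toEuclideanLin_floquetMatrix (hJ : J.IsPeriodic q) (x : ℝ) :
    Matrix.toEuclideanLin (floquetMatrix q J x) =
      (jacobiFibre q J (x : UnitAddCircle)).toLinearMap := by
  refine (EuclideanSpace.basisFun (Fin q) ℂ).toBasis.ext fun k => ?_
  ext j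
  rw [OrthonormalBasis.coe_toBasis, EuclideanSpace.basisFun_apply,
    ContinuousLinearMap.coe_coe, ← fibreVec_natCast q k (x : UnitAddCircle),
    jacobiFibre_fibreVec q hJ, PiLp.add_apply, PiLp.add_apply, PiLp.smul_apply, PiLp.smul_apply,
    PiLp.smul_apply, fibreVec_natCast_add_one_apply, fibreVec_natCast_sub_one_apply,
    fibreVec_natCast]
  have hentry : Matrix.toEuclideanLin (floquetMatrix q J x) (EuclideanSpace.single k (1 : ℂ)) j =
      floquetMatrix q J x j k := by
    simp [Matrix.toLpLin_apply]
  rw [hentry, floquetMatrix, Matrix.of_apply, PiLp.single_apply]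
  simp only [smul_eq_mul, mul_add, mul_ite, mul_one, mul_zero]
  have hdiag : (if j = k then (J.b j : ℂ) else 0) = if j = k then (J.b k : ℂ) else 0 := by
    split_ifs with h
    · rw [h]
    · rfl
  have hoff : (if (j : ℕ) + 1 = k then (J.a j : ℂ) else 0) =
      if (j : ℕ) + 1 = k then (J.a (k - 1) : ℂ) else 0 := by
    split_ifs with h
    · rw [show ((k : ℕ) : ℤ) - 1 = j by omega]
    · rfl
  have hcorner : (if (j : ℕ) + 1 = q ∧ (k : ℕ) = 0 then
      (J.a j : ℂ) * Complex.exp (2 * π * x * Complex.I) else 0) =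
      if (j : ℕ) + 1 = q ∧ (k : ℕ) = 0 then
        (J.a (k - 1) : ℂ) * Complex.exp (2 * π * x * Complex.I) else 0 := by
    split_ifs with h
    · rw [show (j : ℤ) = k - 1 + q by omega, (hJ _).1]
    · rfl
  rw [hdiag, hoff, hcorner]
  ring

lemma inner_jacobiFibre (hJ : J.IsPeriodic q) (x : ℝ) (v w : Fibre q) :
    inner ℂ (jacobiFibre q J (x : UnitAddCircle) v) w =
      inner ℂ v (jacobiFibre q J (x : UnitAddCircle) w) := by
  have h := Matrix.isSymmetric_toEuclideanLin_iff.mpr (floquetMatrix_isHermitian q J x)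
  rw [toEuclideanLin_floquetMatrix q hJ] at h
  exact h v w

lemma jacobiFibre_floquetEigenbasis (hJ : J.IsPeriodic q) (x : ℝ) (k : Fin q) :
    jacobiFibre q J (x : UnitAddCircle) (floquetEigenbasis q J x k) =
      (floquetEig q J k x : ℂ) • floquetEigenbasis q J x k := by
  set hH := floquetMatrix_isHermitian q J x
  set e : Fin q ≃ Fin q := (Fin.revPerm.trans (finCongr (Fintype.card_fin q).symm)).trans
    (Fintype.equivOfCardEq (Fintype.card_fin _))
  have heig : hH.eigenvalues (e k) = floquetEig q J k x := by
    rw [Matrix.IsHermitian.eigenvalues, floquetEig]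
    congr 1
    simp [e]
  have hvec : floquetEigenbasis q J x k = hH.eigenvectorBasis (e k) := by
    rw [floquetEigenbasis, OrthonormalBasis.reindex_apply, Equiv.symm_symm]
  have hmulVec := hH.mulVec_eigenvectorBasis (e k)
  rw [heig, ← hvec] at hmulVec
  have hLin : Matrix.toEuclideanLin (floquetMatrix q J x) (floquetEigenbasis q J x k) =
      (floquetEig q J k x : ℂ) • floquetEigenbasis q J x k := by
    ext j
    simpa [Matrix.toLpLin_apply] using congrFun hmulVec j
  rwa [toEuclideanLin_floquetMatrix q hJ x] at hLin

end JacobiFibre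

/-! ### Unimodular two-by-two matrices -/

section Unimodular

open scoped Matrix

lemma trace_pow_eq_eval_chebyshev_C {A : Type*} [CommRing A] {N : Matrix (Fin 2) (Fin 2) A}
    (hN : N.det = 1) (r : ℕ) : (N ^ r).trace = (Polynomial.Chebyshev.C A r).eval N.trace := by
  have hcayley : N ^ 2 = N.trace • N - 1 := by
    have hdet := hN
    rw [Matrix.det_fin_two] at hdet
    ext i j
    fin_cases i <;> fin_cases j <;>
      simp [pow_two, Matrix.mul_apply, Fin.sum_univ_two, Matrix.trace_fin_two]
    · linear_combination -hdet
    · ring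
    · ring
    · linear_combination -hdet
  induction r using Nat.twoStepInduction with
  | zero => simp
  | one => simp
  | more r ih0 ih1 =>
    have hpow : N ^ (r + 2) = N.trace • N ^ (r + 1) - N ^ r := by
      rw [pow_add, hcayley, mul_sub, mul_one, Matrix.mul_smul, pow_succ]
    have hC := Polynomial.Chebyshev.C_add_two A r
    push_cast at ih1 ⊢
    rw [hpow, Matrix.trace_sub, Matrix.trace_smul, ih0, ih1, hC, Polynomial.eval_sub,
      Polynomial.eval_mul, Polynomial.eval_X, smul_eq_mul]

variable {K : Type*} [Field K] {N : Matrix (Fin 2) (Fin 2) K} {z : K} {s s' : Fin 2 → K}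

lemma trace_eq_add_inv_of_mulVec_eq_smul (hN : N.det = 1) (hs : N *ᵥ s = z • s) (hs0 : s ≠ 0) :
    N.trace = z + z⁻¹ := by
  have hdet : (N - z • (1 : Matrix (Fin 2) (Fin 2) K)).det = 0 := by
    rw [← Matrix.exists_mulVec_eq_zero_iff]
    refine ⟨s, hs0, ?_⟩
    rw [Matrix.sub_mulVec, hs, Matrix.smul_mulVec, Matrix.one_mulVec, sub_self]
  rw [Matrix.det_fin_two] at hdet hN
  simp only [Matrix.sub_apply, Matrix.smul_apply, Matrix.one_apply_eq, smul_eq_mul, mul_one,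
    Matrix.one_apply_ne, ne_eq, zero_ne_one, one_ne_zero, not_false_eq_true, mul_zero,
    sub_zero] at hdet
  have hquad : z * N.trace = z ^ 2 + 1 := by
    rw [Matrix.trace_fin_two]
    linear_combination hN - hdet
  have hz : z ≠ 0 := by
    rintro rfl
    simp at hquad
  field_simp
  linear_combination hquad

lemma sq_eq_one_of_mulVec_eq_smul (hN : N.det = 1) (hs : N *ᵥ s = z • s) (hs' : N *ᵥ s' = z • s')
    (hind : LinearIndependent K ![s, s']) : z ^ 2 = 1 := by
  have hcomm : N * (Matrix.of ![s, s']).transpose = z • (Matrix.of ![s, s']).transpose := by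
    ext i j
    fin_cases j
    · exact congrFun hs i
    · exact congrFun hs' i
  have hdet := congrArg Matrix.det hcomm
  rw [Matrix.det_mul, hN, one_mul, Matrix.det_smul, Fintype.card_fin, Matrix.det_transpose] at hdet
  have hunit : IsUnit (Matrix.of ![s, s']) := Matrix.linearIndependent_rows_iff_isUnit.mp hind
  exact (mul_eq_right₀ ((Matrix.isUnit_iff_isUnit_det _).mp hunit).ne_zero).mp hdet.symm

end Unimodular

/-! ### Transfer matrices and the discriminant -/

section Transfer

open scoped Matrix

variable (J : JacobiMatrix)

lemma JacobiMatrix.pos_a (n : ℤ) : 0 < J.a n := by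
  obtain ⟨δ, hδ, h⟩ := J.a_pos
  exact hδ.trans_le (h n)

/-- One step of the transfer matrix, acting on `(ψ_m, a_{m-1} ψ_{m-1})`. -/
def transferStep (m : ℕ) : Matrix (Fin 2) (Fin 2) (Polynomial ℝ) :=
  !![Polynomial.C (1 / J.a m) * (Polynomial.X - Polynomial.C (J.b m)),
      -Polynomial.C (1 / J.a m); Polynomial.C (J.a m), 0]

/-- The transfer matrix from `0` to `m`, with polynomial entries in the energy. -/
def transferPoly : ℕ → Matrix (Fin 2) (Fin 2) (Polynomial ℝ)
  | 0 => 1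
  | m + 1 => transferStep J m * transferPoly m

/-- Half the trace of the transfer matrix, the discriminant of a periodic Jacobi matrix. -/
def discr (m : ℕ) : Polynomial ℝ := Polynomial.C (1 / 2) * (transferPoly J m).trace

lemma det_transferPoly (m : ℕ) : (transferPoly J m).det = 1 := by
  induction m with
  | zero => simp [transferPoly]
  | succ m ih =>
    rw [transferPoly, Matrix.det_mul, ih, mul_one, transferStep, Matrix.det_fin_two_of, mul_zero,
      zero_sub, neg_mul, neg_neg, ← Polynomial.C_mul, div_mul_cancel₀ _ (J.pos_a m).ne',
      Polynomial.C_1]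

lemma natDegree_transferStep_le (m : ℕ) (i j : Fin 2) : (transferStep J m i j).natDegree ≤ 1 := by
  fin_cases i <;> fin_cases j <;> simp only [transferStep, Fin.zero_eta, Fin.mk_one,
    Matrix.of_apply, Matrix.cons_val', Matrix.cons_val_zero, Matrix.cons_val_one,
    Matrix.cons_val_fin_one] <;> compute_degree <;> norm_num

lemma natDegree_transferPoly_le (m : ℕ) (i j : Fin 2) :
    (transferPoly J m i j).natDegree ≤ m := by
  induction m generalizing i j with
  | zero =>
    rw [transferPoly, Matrix.one_apply]
    split_ifs <;> simp
  | succ m ih =>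
    rw [transferPoly, Matrix.mul_apply, add_comm]
    exact Polynomial.natDegree_sum_le_of_forall_le _ _ fun k _ =>
      Polynomial.natDegree_mul_le_of_le (natDegree_transferStep_le J m i k) (ih k j)

lemma natDegree_discr_le (m : ℕ) : (discr J m).natDegree ≤ m := by
  rw [discr, Matrix.trace_fin_two]
  exact (Polynomial.natDegree_C_mul_le _ _).trans (Polynomial.natDegree_add_le_of_degree_le
    (natDegree_transferPoly_le J m 0 0) (natDegree_transferPoly_le J m 1 1))

/-- The transfer matrix at a given energy. -/
def transferMat (μ : ℝ) (m : ℕ) : Matrix (Fin 2) (Fin 2) ℝ :=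
  (Polynomial.evalRingHom μ).mapMatrix (transferPoly J m)

lemma transferMat_zero (μ : ℝ) : transferMat J μ 0 = 1 := by
  rw [transferMat, transferPoly, map_one]

lemma transferMat_succ (μ : ℝ) (m : ℕ) :
    transferMat J μ (m + 1) =
      !![1 / J.a m * (μ - J.b m), -(1 / J.a m); J.a m, 0] * transferMat J μ m := by
  rw [transferMat, transferPoly, map_mul, transferMat]
  congr 1
  ext i j
  fin_cases i <;> fin_cases j <;> simp [transferStep]

lemma det_transferMat (μ : ℝ) (m : ℕ) : (transferMat J μ m).det = 1 := by
  rw [transferMat, ← RingHom.map_det, det_transferPoly, map_one]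

lemma eval_discr (μ : ℝ) (m : ℕ) :
    (discr J m).eval μ = 1 / 2 * (transferMat J μ m).trace := by
  rw [discr, transferMat, Matrix.trace_fin_two, Matrix.trace_fin_two]
  simp

variable {J}

lemma transferPoly_add {p : ℕ} (hJ : J.IsPeriodic p) (m : ℕ) :
    transferPoly J (m + p) = transferPoly J m * transferPoly J p := by
  induction m with
  | zero => simp [transferPoly]
  | succ m ih =>
    have hs : transferStep J (m + p) = transferStep J m := by
      simp only [transferStep, Nat.cast_add, (hJ _).1, (hJ _).2]
    rw [show m + 1 + p = (m + p) + 1 by ring, transferPoly, ih, hs, transferPoly, mul_assoc]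

lemma transferPoly_mul {p : ℕ} (hJ : J.IsPeriodic p) (r : ℕ) :
    transferPoly J (p * r) = transferPoly J p ^ r := by
  induction r with
  | zero => simp [transferPoly]
  | succ r ih => rw [mul_add, mul_one, transferPoly_add hJ, ih, pow_succ]

lemma eval_discr_mul {p : ℕ} (hJ : J.IsPeriodic p) (μ : ℝ) (r : ℕ) :
    (discr J (p * r)).eval μ = (Polynomial.Chebyshev.T ℝ r).eval ((discr J p).eval μ) := by
  have hcomp := congrArg (Polynomial.eval ((discr J p).eval μ))
    (Polynomial.Chebyshev.C_comp_two_mul_X ℝ r)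
  have htrace : 2 * (discr J p).eval μ = (transferMat J μ p).trace := by
    rw [eval_discr]
    ring
  simp only [Polynomial.eval_comp, Polynomial.eval_mul, Polynomial.eval_ofNat, Polynomial.eval_X,
    htrace] at hcomp
  rw [eval_discr J μ (p * r), transferMat, transferPoly_mul hJ, map_pow, ← transferMat,
    trace_pow_eq_eval_chebyshev_C (det_transferMat J μ p), hcomp]
  ring

/-- The state vector `(ψ_m, a_{m-1} ψ_{m-1})` of a solution. -/
def stateVec (J : JacobiMatrix) (ψ : ℤ → ℂ) (m : ℤ) : Fin 2 → ℂ :=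
  ![ψ m, (J.a (m - 1) : ℂ) * ψ (m - 1)]

lemma stateVec_eq_mulVec {μ : ℝ} {ψ : ℤ → ℂ}
    (hψ : ∀ n : ℤ, (J.a n : ℂ) * ψ (n + 1) + J.b n * ψ n + J.a (n - 1) * ψ (n - 1) = μ * ψ n)
    (m : ℕ) : stateVec J ψ m =
      Complex.ofRealHom.mapMatrix (transferMat J μ m) *ᵥ stateVec J ψ 0 := by
  induction m with
  | zero => rw [transferMat_zero, map_one, Matrix.one_mulVec, Nat.cast_zero]
  | succ m ih =>
    rw [transferMat_succ, map_mul, ← Matrix.mulVec_mulVec, ← ih]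
    have ha : (J.a m : ℂ) ≠ 0 := Complex.ofReal_ne_zero.mpr (J.pos_a m).ne'
    have h := hψ m
    ext i
    fin_cases i
    · simp [stateVec, Matrix.mulVec, dotProduct, Fin.sum_univ_two]
      field_simp
      linear_combination h
    · simp [stateVec, Matrix.mulVec, dotProduct, Fin.sum_univ_two]

end Transfer

/-! ### Floquet solutions -/

section FloquetSolution

open scoped Matrix

variable (q : ℕ) [NeZero q] {J : JacobiMatrix}

/-- The Floquet solution on `ℤ` of a vector in the fibre. -/
def floquetSolution (x : ℝ) (v : Fibre q) (n : ℤ) : ℂ :=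
  inner ℂ (fibreVec q n (x : UnitAddCircle)) v

lemma floquetSolution_natCast (x : ℝ) (v : Fibre q) (k : Fin q) :
    floquetSolution q x v (k : ℤ) = v k := by
  rw [floquetSolution, fibreVec_natCast, EuclideanSpace.inner_single_left]
  simp

lemma floquetSolution_add (x : ℝ) (v : Fibre q) (n : ℤ) :
    floquetSolution q x v (n + q) =
      Complex.exp (2 * π * x * Complex.I) * floquetSolution q x v n := by
  have h := fibreVec_add_mul q n 1 (x : UnitAddCircle)
  rw [one_mul] at h
  rw [floquetSolution, h, inner_smul_left, fourier_neg, Complex.conj_conj, fourier_coe_unit,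
    floquetSolution]
  congr 2
  push_cast
  ring

lemma floquetSolution_eq (hJ : J.IsPeriodic q) {x μ : ℝ} {v : Fibre q}
    (hv : jacobiFibre q J (x : UnitAddCircle) v = (μ : ℂ) • v) (n : ℤ) :
    (J.a n : ℂ) * floquetSolution q x v (n + 1) + J.b n * floquetSolution q x v n +
      J.a (n - 1) * floquetSolution q x v (n - 1) = μ * floquetSolution q x v n := by
  have h := inner_jacobiFibre q hJ x (fibreVec q n (x : UnitAddCircle)) v
  rw [hv, jacobiFibre_fibreVec q hJ, inner_smul_right] at h
  simpa [inner_add_left, inner_smul_left, floquetSolution] using h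

lemma stateVec_floquetSolution_add_smul (x : ℝ) (v w : Fibre q) (α β : ℂ) :
    stateVec J (floquetSolution q x (α • v + β • w)) 0 =
      α • stateVec J (floquetSolution q x v) 0 + β • stateVec J (floquetSolution q x w) 0 := by
  ext i
  fin_cases i <;>
    simp only [stateVec, floquetSolution, inner_add_right, inner_smul_right] <;> simp
  ring

section Eigenvector

variable {q} {x μ : ℝ} {v w : Fibre q}

lemma eq_zero_of_stateVec_eq_zero (hJ : J.IsPeriodic q)
    (hv : jacobiFibre q J (x : UnitAddCircle) v = (μ : ℂ) • v)
    (h0 : stateVec J (floquetSolution q x v) 0 = 0) : v = 0 := by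
  ext k
  have h := stateVec_eq_mulVec (floquetSolution_eq q hJ hv) k
  rw [h0, Matrix.mulVec_zero] at h
  simpa [stateVec, floquetSolution_natCast] using congrFun h 0

lemma mulVec_stateVec_floquetSolution (hJ : J.IsPeriodic q)
    (hv : jacobiFibre q J (x : UnitAddCircle) v = (μ : ℂ) • v) :
    Complex.ofRealHom.mapMatrix (transferMat J μ q) *ᵥ stateVec J (floquetSolution q x v) 0 =
      Complex.exp (2 * π * x * Complex.I) • stateVec J (floquetSolution q x v) 0 := by
  rw [← stateVec_eq_mulVec (floquetSolution_eq q hJ hv) q]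
  have h0 := floquetSolution_add q x v 0
  have h1 := floquetSolution_add q x v (-1)
  have ha := hJ.periodic_a (-1)
  rw [zero_add] at h0
  rw [neg_add_eq_sub] at h1 ha
  ext i
  fin_cases i
  · simp [stateVec, h0]
  · simp [stateVec, h1, ha]
    ring

lemma det_mapMatrix_transferMat (J : JacobiMatrix) (μ : ℝ) (m : ℕ) :
    (Complex.ofRealHom.mapMatrix (transferMat J μ m)).det = 1 := by
  rw [← RingHom.map_det, det_transferMat, map_one]

lemma eval_discr_of_eigenvector (hJ : J.IsPeriodic q)
    (hv : jacobiFibre q J (x : UnitAddCircle) v = (μ : ℂ) • v) (hv0 : v ≠ 0) :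
    (discr J q).eval μ = Real.cos (2 * π * x) := by
  have htrace := trace_eq_add_inv_of_mulVec_eq_smul (det_mapMatrix_transferMat J μ q)
    (mulVec_stateVec_floquetSolution hJ hv) fun h => hv0 (eq_zero_of_stateVec_eq_zero hJ hv h)
  rw [eval_discr, ← Complex.ofReal_inj]
  push_cast
  rw [Complex.cos, neg_mul, Complex.exp_neg, ← htrace]
  simp [Matrix.trace_fin_two]
  ring

lemma not_linearIndependent_eigenvectors (hJ : J.IsPeriodic q) (hx : Real.sin (2 * π * x) ≠ 0)
    (hv : jacobiFibre q J (x : UnitAddCircle) v = (μ : ℂ) • v)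
    (hw : jacobiFibre q J (x : UnitAddCircle) w = (μ : ℂ) • w) :
    ¬ LinearIndependent ℂ ![v, w] := by
  intro hind
  have hstate : LinearIndependent ℂ ![stateVec J (floquetSolution q x v) 0,
      stateVec J (floquetSolution q x w) 0] := by
    rw [LinearIndependent.pair_iff] at hind ⊢
    intro α β h
    rw [← stateVec_floquetSolution_add_smul] at h
    refine hind α β (eq_zero_of_stateVec_eq_zero (x := x) (μ := μ) hJ ?_ h)
    rw [map_add, map_smul, map_smul, hv, hw]
    module
  have hsq := sq_eq_one_of_mulVec_eq_smul (det_mapMatrix_transferMat J μ q)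
    (mulVec_stateVec_floquetSolution hJ hv) (mulVec_stateVec_floquetSolution hJ hw) hstate
  have him : (Complex.exp (2 * π * x * Complex.I)).im = Real.sin (2 * π * x) := by
    exact_mod_cast Complex.exp_ofReal_mul_I_im (2 * π * x)
  apply hx
  rw [← him]
  rw [sq, mul_self_eq_one_iff] at hsq
  obtain h | h := hsq <;> simp [h]

end Eigenvector

lemma floquetEig_strictMono (hJ : J.IsPeriodic q) {x : ℝ} (hx : Real.sin (2 * π * x) ≠ 0) :
    StrictMono fun k : Fin q => floquetEig q J k x := by
  refine (floquetEig_monotone q J x).strictMono_of_injective fun k l hkl => ?_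
  by_contra hne
  have hk := jacobiFibre_floquetEigenbasis q hJ x k
  rw [show floquetEig q J k x = floquetEig q J l x from hkl] at hk
  refine not_linearIndependent_eigenvectors hJ hx hk (jacobiFibre_floquetEigenbasis q hJ x l) ?_
  have hpair : ![floquetEigenbasis q J x k, floquetEigenbasis q J x l] =
      floquetEigenbasis q J x ∘ ![k, l] := by
    funext i
    fin_cases i <;> rfl
  rw [hpair]
  exact (floquetEigenbasis q J x).orthonormal.linearIndependent.comp _
    (injective_pair_iff_ne.mpr hne)

lemma eval_discr_floquetEig (hJ : J.IsPeriodic q) (k : Fin q) (x : ℝ) :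
    (discr J q).eval (floquetEig q J k x) = Real.cos (2 * π * x) :=
  eval_discr_of_eigenvector hJ (jacobiFibre_floquetEigenbasis q hJ x k)
    ((floquetEigenbasis q J x).orthonormal.ne_zero k)

end FloquetSolution

/-! ### Differentiability of the band functions and Last's lower bound -/

section Bands

variable (q : ℕ) [NeZero q] {J : JacobiMatrix} {x : ℝ}

lemma discr_sub_C_ne_zero (hJ : J.IsPeriodic q) (c : ℝ) : discr J q - Polynomial.C c ≠ 0 := by
  intro h
  have h0 := eval_discr_floquetEig q hJ 0 0
  have h1 := eval_discr_floquetEig q hJ 0 (1 / 2)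
  rw [sub_eq_zero.mp h, Polynomial.eval_C] at h0 h1
  rw [h0, show 2 * π * (1 / 2) = π by ring, mul_zero, Real.cos_zero, Real.cos_pi] at h1
  norm_num at h1

lemma isRoot_discr_sub_C_floquetEig (hJ : J.IsPeriodic q) (k : Fin q) (x : ℝ) :
    (discr J q - Polynomial.C (Real.cos (2 * π * x))).IsRoot (floquetEig q J k x) := by
  rw [Polynomial.IsRoot, Polynomial.eval_sub, Polynomial.eval_C, eval_discr_floquetEig q hJ,
    sub_self]

lemma roots_discr_sub_C (hJ : J.IsPeriodic q) (hx : Real.sin (2 * π * x) ≠ 0) :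
    (discr J q - Polynomial.C (Real.cos (2 * π * x))).roots =
      (Finset.univ.image fun k : Fin q => floquetEig q J k x).val := by
  symm
  apply Multiset.eq_of_le_of_card_le
  · rw [Multiset.le_iff_subset (Finset.nodup _)]
    intro μ hμ
    rw [Finset.mem_val, Finset.mem_image] at hμ
    obtain ⟨k, -, rfl⟩ := hμ
    exact (Polynomial.mem_roots (discr_sub_C_ne_zero q hJ _)).mpr
      (isRoot_discr_sub_C_floquetEig q hJ k x)
  · rw [Finset.card_val, Finset.card_image_of_injective _ (floquetEig_strictMono q hJ hx).injective,
      Finset.card_univ, Fintype.card_fin]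
    refine (Polynomial.card_roots' _).trans ?_
    rw [Polynomial.natDegree_sub_C]
    exact natDegree_discr_le J q

lemma exists_floquetEig_eq (hJ : J.IsPeriodic q) (hx : Real.sin (2 * π * x) ≠ 0) {μ : ℝ}
    (hμ : (discr J q).eval μ = Real.cos (2 * π * x)) : ∃ k : Fin q, floquetEig q J k x = μ := by
  have hmem : μ ∈ (discr J q - Polynomial.C (Real.cos (2 * π * x))).roots := by
    rw [Polynomial.mem_roots (discr_sub_C_ne_zero q hJ _), Polynomial.IsRoot, Polynomial.eval_sub,
      Polynomial.eval_C, hμ, sub_self]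
  rw [roots_discr_sub_C q hJ hx, Finset.mem_val, Finset.mem_image] at hmem
  obtain ⟨k, -, hk⟩ := hmem
  exact ⟨k, hk⟩

lemma derivative_discr_ne_zero (hJ : J.IsPeriodic q) (hx : Real.sin (2 * π * x) ≠ 0)
    (k : Fin q) : (Polynomial.derivative (discr J q)).eval (floquetEig q J k x) ≠ 0 := by
  intro hd
  have hmult : 1 < (discr J q - Polynomial.C (Real.cos (2 * π * x))).rootMultiplicity
      (floquetEig q J k x) := by
    rw [Polynomial.one_lt_rootMultiplicity_iff_isRoot (discr_sub_C_ne_zero q hJ _)]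
    refine ⟨isRoot_discr_sub_C_floquetEig q hJ k x, ?_⟩
    rw [Polynomial.IsRoot, Polynomial.derivative_sub, Polynomial.derivative_C, sub_zero, hd]
  rw [← Polynomial.count_roots, roots_discr_sub_C q hJ hx] at hmult
  exact hmult.not_ge (Multiset.nodup_iff_count_le_one.mp (Finset.nodup _) _)

lemma continuous_floquetEig (hJ : J.IsPeriodic q) (k : Fin q) : Continuous (floquetEig q J k) := by
  refine continuous_iff_continuousAt.mpr fun x => ?_
  have hfibre : Continuous fun y : ℝ => jacobiFibre q J (y : UnitAddCircle) :=
    (jacobiFibre q J).continuous.comp (AddCircle.continuous_mk' 1)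
  refine tendsto_iff_dist_tendsto_zero.mpr (squeeze_zero (fun _ => dist_nonneg) (fun y => ?_)
    (tendsto_iff_dist_tendsto_zero.mp (hfibre.tendsto x)))
  rw [Real.dist_eq, dist_eq_norm]
  exact abs_eigenvalue_sub_le_opNorm_sub (floquetEig_monotone q J y) (floquetEig_monotone q J x)
    (jacobiFibre_floquetEigenbasis q hJ y) (jacobiFibre_floquetEigenbasis q hJ x) k

/-- Near `x` the band function is `Δ⁻¹ ∘ cos(2π ·)` for the local inverse `Δ⁻¹` of the
discriminant. -/
lemma hasDerivAt_floquetEig (hJ : J.IsPeriodic q) (hx : Real.sin (2 * π * x) ≠ 0) (k : Fin q) :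
    HasDerivAt (floquetEig q J k)
      (((Polynomial.derivative (discr J q)).eval (floquetEig q J k x))⁻¹ *
        (-(2 * π * Real.sin (2 * π * x)))) x := by
  have hΔ : HasStrictDerivAt (fun μ => (discr J q).eval μ)
      ((Polynomial.derivative (discr J q)).eval (floquetEig q J k x)) (floquetEig q J k x) :=
    (discr J q).hasStrictDerivAt _
  have hΔ0 := derivative_discr_ne_zero q hJ hx k
  have hinv := (hΔ.to_localInverse hΔ0).hasDerivAt
  have hleft := (continuous_floquetEig q hJ k).continuousAt.eventually
    (hΔ.eventually_left_inverse hΔ0)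
  simp only [eval_discr_floquetEig q hJ] at hinv hleft
  have hcos : HasDerivAt (fun y : ℝ => Real.cos (2 * π * y)) (-(2 * π * Real.sin (2 * π * x)))
      x := by
    have hlin : HasDerivAt (fun y : ℝ => 2 * π * y) (2 * π) x := by
      simpa using (hasDerivAt_id x).const_mul (2 * π)
    convert! hlin.cos using 1
    ring
  refine (hinv.comp x hcos).congr_of_eventuallyEq ?_
  filter_upwards [hleft] with y hy
  exact hy.symm

end Bands

section Growth

variable (q : ℕ) [NeZero q] {J : JacobiMatrix} {R : ℝ}

lemma JacobiMatrix.IsRBounded.norm_a_le (hR : J.IsRBounded R) (n : ℤ) : ‖(J.a n : ℂ)‖ ≤ R := by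
  rw [Complex.norm_real, Real.norm_eq_abs, abs_of_pos (J.pos_a n)]
  exact (hR n).2.1

lemma abs_floquetEig_le (hJ : J.IsPeriodic q) (hR : J.IsRBounded R) (k : Fin q) (x : ℝ) :
    |floquetEig q J k x| ≤ 3 * R := by
  have hb (n : ℤ) : ‖(J.b n : ℂ)‖ ≤ R := by
    rw [Complex.norm_real, Real.norm_eq_abs]
    exact (hR n).2.2
  have hnorm : ‖jacobiFibre q J (x : UnitAddCircle)‖ ≤ R + R + R :=
    norm_triFibre_le q hR.norm_a_le hb (fun n => hR.norm_a_le (n - 1)) _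
  have heig := (jacobiFibre q J (x : UnitAddCircle)).le_opNorm (floquetEigenbasis q J x k)
  rw [jacobiFibre_floquetEigenbasis q hJ, norm_smul, OrthonormalBasis.norm_eq_one, mul_one,
    mul_one, Complex.norm_real, Real.norm_eq_abs] at heig
  linarith

lemma transferPoly_succ_zero (J : JacobiMatrix) (m : ℕ) (j : Fin 2) :
    transferPoly J (m + 1) 0 j = Polynomial.C (1 / J.a m) *
      ((Polynomial.X - Polynomial.C (J.b m)) * transferPoly J m 0 j - transferPoly J m 1 j) := by
  rw [transferPoly, Matrix.mul_apply, Fin.sum_univ_two, transferStep]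
  simp
  ring

lemma transferPoly_succ_one (J : JacobiMatrix) (m : ℕ) (j : Fin 2) :
    transferPoly J (m + 1) 1 j = Polynomial.C (J.a m) * transferPoly J m 0 j := by
  rw [transferPoly, Matrix.mul_apply, Fin.sum_univ_two, transferStep]
  simp

/-- A bound for one transfer step at the energies `|μ| ≤ 3R`, on the class `𝒥(R)`. -/
def transferRate (R : ℝ) : ℝ := 4 * R ^ 2 + R + 1

lemma le_transferRate (R : ℝ) : R ≤ transferRate R := by
  unfold transferRate
  nlinarith

lemma one_lt_transferRate (hR : 0 < R) : 1 < transferRate R := by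
  unfold transferRate
  nlinarith

variable {μ : ℝ}

lemma abs_transferStep_le (hR : J.IsRBounded R) (hμ : |μ| ≤ 3 * R) (m : ℤ) {s t B : ℝ}
    (hs : |s| ≤ B) (ht : |t| ≤ B) :
    |1 / J.a m * ((μ - J.b m) * s - t)| ≤ (4 * R ^ 2 + R) * B := by
  obtain ⟨hlow, hupp, hb⟩ := hR m
  have ha := J.pos_a m
  have hR0 : 0 < R := ha.trans_le hupp
  have : 0 ≤ B := (abs_nonneg s).trans hs
  have hinv : 1 / J.a m ≤ R := (one_div_le hR0 ha).mp hlow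
  have henergy : |μ - J.b m| ≤ 4 * R := (abs_sub _ _).trans (by linarith)
  calc |1 / J.a m * ((μ - J.b m) * s - t)|
      = 1 / J.a m * |(μ - J.b m) * s - t| := by rw [abs_mul, abs_of_pos (by positivity)]
    _ ≤ 1 / J.a m * (|μ - J.b m| * |s| + |t|) := by
      rw [← abs_mul]
      gcongr
      exact abs_sub _ _
    _ ≤ R * (4 * R * B + B) := by gcongr
    _ = (4 * R ^ 2 + R) * B := by ring

lemma abs_eval_transferPoly_le (hR : J.IsRBounded R) (hμ : |μ| ≤ 3 * R) (m : ℕ) (i j : Fin 2) :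
    |(transferPoly J m i j).eval μ| ≤ transferRate R ^ m := by
  have hR0 : 0 < R := (J.pos_a 0).trans_le (hR 0).2.1
  have hrate := one_lt_transferRate hR0
  induction m generalizing i j with
  | zero =>
    rw [transferPoly, Matrix.one_apply]
    split_ifs <;> simp
  | succ m ih =>
    rw [pow_succ']
    match i with
    | 0 =>
      rw [transferPoly_succ_zero]
      simp only [Polynomial.eval_sub, Polynomial.eval_mul, Polynomial.eval_C, Polynomial.eval_X]
      refine (abs_transferStep_le hR hμ m (ih 0 j) (ih 1 j)).trans ?_
      gcongr
      unfold transferRate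
      linarith
    | 1 =>
      rw [transferPoly_succ_one, Polynomial.eval_mul, Polynomial.eval_C, abs_mul,
        abs_of_pos (J.pos_a m)]
      gcongr
      · exact (hR m).2.1.trans (le_transferRate R)
      · exact ih 0 j

lemma abs_one_div_mul_eval_transferPoly_le (hR : J.IsRBounded R) (hμ : |μ| ≤ 3 * R) (m : ℕ)
    (j : Fin 2) : |1 / J.a m * (transferPoly J m 0 j).eval μ| ≤ transferRate R ^ (m + 1) := by
  have hR0 : 0 < R := (J.pos_a 0).trans_le (hR 0).2.1
  have hrate := one_lt_transferRate hR0
  rw [abs_mul, abs_of_pos (one_div_pos.mpr (J.pos_a m)), pow_succ']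
  gcongr
  · exact ((one_div_le hR0 (J.pos_a m)).mp (hR m).1).trans (le_transferRate R)
  · exact abs_eval_transferPoly_le hR hμ m 0 j

lemma abs_eval_derivative_transferPoly_le (hR : J.IsRBounded R) (hμ : |μ| ≤ 3 * R) (m : ℕ)
    (i j : Fin 2) :
    |(Polynomial.derivative (transferPoly J m i j)).eval μ| ≤ m * transferRate R ^ m := by
  have hR0 : 0 < R := (J.pos_a 0).trans_le (hR 0).2.1
  have hrate := one_lt_transferRate hR0
  induction m generalizing i j with
  | zero =>
    rw [transferPoly, Matrix.one_apply]
    split_ifs <;> simp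
  | succ m ih =>
    have hsum : ((m + 1 : ℕ) : ℝ) * transferRate R ^ (m + 1) =
        transferRate R ^ (m + 1) + transferRate R * (m * transferRate R ^ m) := by
      push_cast
      ring
    rw [hsum]
    match i with
    | 0 =>
      rw [transferPoly_succ_zero]
      simp only [Polynomial.derivative_sub, Polynomial.derivative_mul, Polynomial.derivative_C,
        Polynomial.derivative_X, zero_mul, zero_add, sub_zero, one_mul, Polynomial.eval_sub,
        Polynomial.eval_mul, Polynomial.eval_add, Polynomial.eval_C, Polynomial.eval_X]
      rw [add_sub_assoc, mul_add]
      refine (abs_add_le _ _).trans (add_le_add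
        (abs_one_div_mul_eval_transferPoly_le hR hμ m j)
        ((abs_transferStep_le hR hμ m (ih 0 j) (ih 1 j)).trans ?_))
      gcongr
      unfold transferRate
      linarith
    | 1 =>
      rw [transferPoly_succ_one, Polynomial.derivative_C_mul, Polynomial.eval_mul,
        Polynomial.eval_C, abs_mul, abs_of_pos (J.pos_a m)]
      refine le_add_of_nonneg_of_le (by positivity) ?_
      gcongr
      · exact (hR m).2.1.trans (le_transferRate R)
      · exact ih 0 j

lemma abs_derivative_discr_le (hR : J.IsRBounded R) (hμ : |μ| ≤ 3 * R) (m : ℕ) :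
    |(Polynomial.derivative (discr J m)).eval μ| ≤ m * transferRate R ^ m := by
  have h0 := abs_eval_derivative_transferPoly_le hR hμ m 0 0
  have h1 := abs_eval_derivative_transferPoly_le hR hμ m 1 1
  have hadd := abs_add_le ((Polynomial.derivative (transferPoly J m 0 0)).eval μ)
    ((Polynomial.derivative (transferPoly J m 1 1)).eval μ)
  rw [discr, Matrix.trace_fin_two, Polynomial.derivative_C_mul, Polynomial.derivative_add,
    Polynomial.eval_mul, Polynomial.eval_C, Polynomial.eval_add, abs_mul,
    abs_of_pos (by norm_num : (0 : ℝ) < 1 / 2)]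
  linarith

end Growth

theorem exists_isLastConstant {R : ℝ} (hR : 0 < R) : ∃ c : ℝ, 0 < c ∧ IsLastConstant R c := by
  have hrate := one_lt_transferRate hR
  have hlog : 0 < Real.log (transferRate R) := Real.log_pos hrate
  refine ⟨1 + Real.log (transferRate R), by linarith, ?_⟩
  intro q J hq hJ hJR k x
  have : NeZero q := ⟨by omega⟩
  by_cases hx : Real.sin (2 * π * x) = 0
  · rw [hx, abs_zero, mul_zero]
    exact abs_nonneg _
  have hgrowth : (q : ℝ) * transferRate R ^ q ≤
      Real.exp ((1 + Real.log (transferRate R)) * q) := by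
    rw [add_mul, one_mul, Real.exp_add, mul_comm (Real.log _), Real.exp_nat_mul,
      Real.exp_log (by linarith)]
    gcongr
    linarith [Real.add_one_le_exp (q : ℝ)]
  have hd := (abs_derivative_discr_le hJR (abs_floquetEig_le q hJ hJR k x) q).trans hgrowth
  have hd0 := abs_pos.mpr (derivative_discr_ne_zero q hJ hx k)
  have hpi : 1 ≤ 2 * π := by linarith [Real.pi_gt_three]
  rw [(hasDerivAt_floquetEig q hJ hx k).deriv, abs_mul, abs_inv, abs_neg, abs_mul,
    abs_of_pos (by positivity : (0 : ℝ) < 2 * π), Real.exp_neg]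
  gcongr
  exact le_mul_of_one_le_left (abs_nonneg _) hpi

/-! ### Spectral gaps -/

lemma one_sub_abs_le_of_exit {f f' : ℝ → ℝ} (hf : ∀ x, HasDerivAt f (f' x) x) {K : ℝ}
    (hK : ∀ x, |f x| < 1 → |f' x| ≤ K) {a ξ : ℝ} (hlt : a < ξ) (ha : |f a| < 1)
    (hξ : 1 ≤ |f ξ|) : 1 - |f a| ≤ K * (ξ - a) := by
  have hcont : Continuous f := continuous_iff_continuousAt.mpr fun x => (hf x).continuousAt
  have hcomp : IsCompact (Set.Icc a ξ ∩ {x | 1 ≤ |f x|}) :=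
    isCompact_Icc.inter_right (isClosed_le continuous_const hcont.abs)
  obtain ⟨c, ⟨⟨hac, hcξ⟩, hc⟩, hfirst⟩ := hcomp.exists_isLeast ⟨ξ, ⟨hlt.le, le_rfl⟩, hξ⟩
  have hac' : a < c := hac.lt_of_ne (by rintro rfl; exact absurd hc (not_le.mpr ha))
  obtain ⟨s, ⟨has, hsc⟩, hslope⟩ := exists_hasDerivAt_eq_slope f f' hac' hcont.continuousOn
    fun x _ => hf x
  have hfs : |f s| < 1 := by
    by_contra! h
    exact absurd (hfirst ⟨⟨has.le, hsc.le.trans hcξ⟩, h⟩) (not_le.mpr hsc)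
  have hs := hK s hfs
  have hK0 : 0 ≤ K := (abs_nonneg _).trans hs
  have hca : 0 < c - a := sub_pos.mpr hac'
  rw [hslope, abs_div, abs_of_pos hca, div_le_iff₀ hca] at hs
  calc 1 - |f a| ≤ |f c| - |f a| := sub_le_sub_right hc _
    _ ≤ |f c - f a| := abs_sub_abs_le_abs_sub _ _
    _ ≤ K * (c - a) := hs
    _ ≤ K * (ξ - a) := by gcongr

-- Two solutions of `f = v` are separated by a critical point, and there `|f| ≥ 1`.
lemma two_mul_one_sub_abs_le {f f' : ℝ → ℝ} (hf : ∀ x, HasDerivAt f (f' x) x) {K : ℝ}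
    (hK : ∀ x, |f x| < 1 → f' x ≠ 0 ∧ |f' x| ≤ K) {a b v : ℝ} (hab : a < b) (ha : f a = v)
    (hb : f b = v) (hv : |v| < 1) : 2 * (1 - |v|) ≤ K * (b - a) := by
  have hcont : Continuous f := continuous_iff_continuousAt.mpr fun x => (hf x).continuousAt
  obtain ⟨ξ, ⟨haξ, hξb⟩, hcrit⟩ := exists_hasDerivAt_eq_zero hab hcont.continuousOn
    (ha.trans hb.symm) fun x _ => hf x
  have hξ : 1 ≤ |f ξ| := by
    by_contra! h
    exact (hK ξ h).1 hcrit
  have hleft := one_sub_abs_le_of_exit hf (fun x hx => (hK x hx).2) haξ (by rwa [ha]) hξ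
  have hneg : ∀ x, HasDerivAt (fun y => f (-y)) (-f' (-x)) x := fun x => by
    simpa [Function.comp_def] using (hf (-x)).comp x (hasDerivAt_neg x)
  have hright := one_sub_abs_le_of_exit hneg (K := K)
    (fun x hx => by rw [abs_neg]; exact (hK _ hx).2) (neg_lt_neg hξb)
    (by rwa [neg_neg, hb]) (by rwa [neg_neg])
  rw [ha] at hleft
  rw [neg_neg, hb] at hright
  linarith

section Chebyshev

variable {u : ℝ}

lemma abs_lt_one_of_abs_eval_chebyshev_T_lt_one (n : ℤ)
    (hu : |(Polynomial.Chebyshev.T ℝ n).eval u| < 1) : |u| < 1 := by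
  contrapose! hu
  exact Polynomial.Chebyshev.one_le_abs_eval_T_real n hu

lemma derivative_chebyshev_T_ne_zero {n : ℤ} (hn : n ≠ 0)
    (hu : |(Polynomial.Chebyshev.T ℝ n).eval u| < 1) :
    (Polynomial.derivative (Polynomial.Chebyshev.T ℝ n)).eval u ≠ 0 := by
  obtain ⟨hu₁, hu₂⟩ := abs_lt.mp (abs_lt_one_of_abs_eval_chebyshev_T_lt_one n hu)
  obtain ⟨α, rfl⟩ : ∃ α, Real.cos α = u := ⟨_, Real.cos_arccos hu₁.le hu₂.le⟩
  have hU := Polynomial.Chebyshev.U_real_cos α (n - 1)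
  rw [Polynomial.Chebyshev.T_derivative_eq_U, Polynomial.eval_mul, Polynomial.eval_intCast]
  refine mul_ne_zero (Int.cast_ne_zero.mpr hn) fun h0 => hu.ne ?_
  rw [h0, zero_mul, Int.cast_sub, Int.cast_one, sub_add_cancel] at hU
  rw [Polynomial.Chebyshev.T_real_cos, Real.abs_cos_eq_sqrt_one_sub_sin_sq, ← hU]
  simp

lemma abs_derivative_chebyshev_T_le (n : ℤ) (hu : |u| ≤ 1) :
    |(Polynomial.derivative (Polynomial.Chebyshev.T ℝ n)).eval u| ≤ (n : ℝ) ^ 2 := by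
  simpa [Polynomial.Chebyshev.derivative_T_eval_one] using
    Polynomial.Chebyshev.abs_iterate_derivative_T_real_le n 1 hu

end Chebyshev

lemma exists_cos_two_pi_mul_eq {u : ℝ} (hu : |u| < 1) :
    ∃ x, Real.cos (2 * π * x) = u ∧ Real.sin (2 * π * x) ≠ 0 := by
  obtain ⟨hu₁, hu₂⟩ := abs_lt.mp hu
  refine ⟨Real.arccos u / (2 * π), ?_⟩
  rw [mul_div_cancel₀ _ Real.two_pi_pos.ne', Real.cos_arccos hu₁.le hu₂.le, Real.sin_arccos]
  exact ⟨rfl, (Real.sqrt_pos.mpr (by nlinarith)).ne'⟩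

section Gaps

variable {J : JacobiMatrix} {p : ℕ} [NeZero p]

lemma derivative_discr_ne_zero_of_abs_lt_one (hJ : J.IsPeriodic p) {μ : ℝ}
    (hμ : |(discr J p).eval μ| < 1) : (Polynomial.derivative (discr J p)).eval μ ≠ 0 := by
  obtain ⟨x, hcos, hsin⟩ := exists_cos_two_pi_mul_eq hμ
  obtain ⟨k, rfl⟩ := exists_floquetEig_eq p hJ hsin hcos.symm
  exact derivative_discr_ne_zero p hJ hsin k

variable {R c : ℝ}

lemma abs_derivative_discr_le_of_abs_lt_one (hL : IsLastConstant R c) (hJ : J.IsPeriodic p)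
    (hR : J.IsRBounded R) {μ : ℝ} (hμ : |(discr J p).eval μ| < 1) :
    |(Polynomial.derivative (discr J p)).eval μ| ≤ 2 * π * Real.exp (c * p) := by
  obtain ⟨x, hcos, hsin⟩ := exists_cos_two_pi_mul_eq hμ
  obtain ⟨k, rfl⟩ := exists_floquetEig_eq p hJ hsin hcos.symm
  have hspeed := hL p J NeZero.one_le hJ hR k x
  rw [(hasDerivAt_floquetEig p hJ hsin k).deriv, abs_mul, abs_inv, abs_neg, abs_mul,
    abs_of_pos Real.two_pi_pos, inv_mul_eq_div,
    le_div_iff₀ (abs_pos.mpr (derivative_discr_ne_zero p hJ hsin k)), Real.exp_neg,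
    inv_mul_eq_div, div_mul_eq_mul_div, div_le_iff₀ (Real.exp_pos _)] at hspeed
  refine le_of_mul_le_mul_left ?_ (abs_pos.mpr hsin)
  linarith

lemma sin_sq_le_mul_gap (hL : IsLastConstant R c) {q r : ℕ} [NeZero q] (hq : q = p * r)
    (hJ : J.IsPeriodic p) (hJq : J.IsPeriodic q) (hR : J.IsRBounded R) {x : ℝ}
    (hx : Real.sin (2 * π * x) ≠ 0) {k l : Fin q} (hkl : k ≠ l) :
    Real.sin (2 * π * x) ^ 2 ≤ (r : ℝ) ^ 2 * (2 * π * Real.exp (c * p)) *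
      |floquetEig q J k x - floquetEig q J l x| := by
  wlog hlt : l < k generalizing k l
  · rw [abs_sub_comm]
    exact this hkl.symm (hkl.lt_of_le (not_lt.mp hlt))
  have hr : (r : ℤ) ≠ 0 := by
    rintro h
    exact NeZero.ne q (by rw [hq, Int.natCast_eq_zero.mp h, mul_zero])
  have hgap : floquetEig q J l x < floquetEig q J k x := floquetEig_strictMono q hJq hx hlt
  set T := Polynomial.Chebyshev.T ℝ r
  have hval (k : Fin q) :
      T.eval ((discr J p).eval (floquetEig q J k x)) = Real.cos (2 * π * x) := by
    rw [← eval_discr_mul hJ, ← hq, eval_discr_floquetEig q hJq]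
  have hcos_sq := Real.sin_sq_add_cos_sq (2 * π * x)
  have hcos : |Real.cos (2 * π * x)| < 1 := by
    rw [← sq_lt_one_iff_abs_lt_one]
    linarith [sq_pos_of_ne_zero hx]
  have hderiv (μ : ℝ) (hμ : |T.eval ((discr J p).eval μ)| < 1) :
      T.derivative.eval ((discr J p).eval μ) * (discr J p).derivative.eval μ ≠ 0 ∧
        |T.derivative.eval ((discr J p).eval μ) * (discr J p).derivative.eval μ| ≤
          (r : ℝ) ^ 2 * (2 * π * Real.exp (c * p)) := by
    have hd := abs_lt_one_of_abs_eval_chebyshev_T_lt_one r hμ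
    refine ⟨mul_ne_zero (derivative_chebyshev_T_ne_zero hr hμ)
      (derivative_discr_ne_zero_of_abs_lt_one hJ hd), ?_⟩
    rw [abs_mul]
    gcongr
    · exact_mod_cast abs_derivative_chebyshev_T_le r hd.le
    · exact abs_derivative_discr_le_of_abs_lt_one hL hJ hR hd
  have hsep := two_mul_one_sub_abs_le
    (fun μ => (T.hasDerivAt _).comp μ ((discr J p).hasDerivAt μ)) hderiv hgap (hval l) (hval k) hcos
  rw [abs_of_pos (sub_pos.mpr hgap)]
  refine le_trans ?_ hsep
  rw [← sq_abs (Real.cos (2 * π * x))] at hcos_sq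
  nlinarith [abs_nonneg (Real.cos (2 * π * x))]

end Gaps

/-! ### The asymptotic velocity in the fibres -/

lemma inner_commutator_eigenvector {E : Type*} [NormedAddCommGroup E] [InnerProductSpace ℂ E]
    {A N : E →L[ℂ] E} (hsymm : ∀ v w, inner ℂ (A v) w = inner ℂ v (A w)) {μ : ℝ} {v : E}
    (hv : A v = (μ : ℂ) • v) : inner ℂ v ((A ∘L N - N ∘L A) v) = 0 := by
  rw [sub_apply, ContinuousLinearMap.comp_apply, ContinuousLinearMap.comp_apply, inner_sub_right,
    ← hsymm, hv, map_smul, inner_smul_left, inner_smul_right, Complex.conj_ofReal, sub_self]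

section FibreQ

variable (q : ℕ) [NeZero q] {J : JacobiMatrix} {x : ℝ}

lemma inner_currentFibre_floquetEigenbasis (hJ : J.IsPeriodic q)
    (hx : Real.sin (2 * π * x) ≠ 0) (k : Fin q) :
    inner ℂ (floquetEigenbasis q J x k)
        (currentFibre q J (x : UnitAddCircle) (floquetEigenbasis q J x k)) =
      (q : ℂ) / (2 * π) * ((deriv (floquetEig q J k) x : ℝ) : ℂ) := by
  have hHF := inner_hasDerivAt_eigenbasis (fun y i => jacobiFibre_floquetEigenbasis q hJ y i)
    (hasDerivAt_triFibre q (fun n => J.a n) (fun n => J.b n) (fun n => J.a (n - 1)) x)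
    (fun i => (continuous_floquetEig q hJ i).continuousAt)
    (fun j hj => (floquetEig_strictMono q hJ hx).injective.ne hj)
    (hasDerivAt_floquetEig q hJ hx k).differentiableAt.hasDerivAt
  have hcomm := inner_commutator_eigenvector (N := indexOp q) (inner_jacobiFibre q hJ x)
    (jacobiFibre_floquetEigenbasis q hJ x k)
  rw [currentFibre_eq_deriv_add_commutator, add_apply, FunLike.coe_smul, Pi.smul_apply,
    FunLike.coe_smul, Pi.smul_apply, inner_add_right, inner_smul_right, inner_smul_right, hHF,
    hcomm, mul_zero, add_zero]

lemma floquetProj_floquetEigenbasis (hJ : J.IsPeriodic q) (hx : Real.sin (2 * π * x) ≠ 0)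
    (k l : Fin q) : floquetProj q J k x (floquetEigenbasis q J x l) =
      if k = l then floquetEigenbasis q J x l else 0 := by
  have hmem (k : Fin q) : floquetEigenbasis q J x k ∈ Module.End.eigenspace
      (Matrix.toEuclideanLin (floquetMatrix q J x)) (floquetEig q J k x : ℂ) := by
    rw [Module.End.mem_eigenspace_iff, toEuclideanLin_floquetMatrix q hJ x]
    exact jacobiFibre_floquetEigenbasis q hJ x k
  split_ifs with hkl
  · subst hkl
    exact Submodule.starProjection_eq_self_iff.mpr (hmem k)
  · rw [floquetProj, Submodule.starProjection_apply_eq_zero_iff, Submodule.mem_orthogonal]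
    intro u hu
    have hne : (floquetEig q J k x : ℂ) ≠ (floquetEig q J l x : ℂ) :=
      Complex.ofReal_injective.ne ((floquetEig_strictMono q hJ hx).injective.ne hkl)
    have hsymm := Matrix.isSymmetric_toEuclideanLin_iff.mpr (floquetMatrix_isHermitian q J x)
    exact hsymm.orthogonalFamily_eigenspaces hne ⟨u, hu⟩ ⟨_, hmem l⟩

lemma fibreQ_floquetEigenbasis (hJ : J.IsPeriodic q) (hx : Real.sin (2 * π * x) ≠ 0)
    (l : Fin q) : fibreQ q J x (floquetEigenbasis q J x l) =
      (inner ℂ (floquetEigenbasis q J x l)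
        (currentFibre q J (x : UnitAddCircle) (floquetEigenbasis q J x l)) : ℂ) •
        floquetEigenbasis q J x l := by
  simp only [inner_currentFibre_floquetEigenbasis q hJ hx, fibreQ, FunLike.coe_smul, Pi.smul_apply,
    sum_apply, floquetProj_floquetEigenbasis q hJ hx, smul_ite, smul_zero, Finset.sum_ite_eq',
    Finset.mem_univ, if_true, smul_smul]

lemma norm_currentFibre_le {R : ℝ} (hR : J.IsRBounded R) (θ : UnitAddCircle) :
    ‖currentFibre q J θ‖ ≤ 2 * R := by
  have h := norm_triFibre_le q (α := fun n => -(Complex.I * J.a n)) (β := fun _ => 0)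
    (γ := fun n => Complex.I * J.a (n - 1)) (A := R) (B := 0) (C := R)
    (fun n => by simpa using hR.norm_a_le n) (fun _ => by simp)
    (fun n => by simpa using hR.norm_a_le (n - 1)) θ
  rwa [add_zero, ← two_mul] at h

variable {R : ℝ}

lemma norm_fibreQ_sub_heisAvg_apply_sq_le (hJ : J.IsPeriodic q) (hR : J.IsRBounded R)
    (hx : Real.sin (2 * π * x) ≠ 0) {ε t : ℝ} (hε : 0 < ε) (ht : 0 < t)
    (hgap : Pairwise fun k l : Fin q => ε ≤ |floquetEig q J k x - floquetEig q J l x|)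
    (v : Fibre q) :
    ‖(fibreQ q J x - heisAvg (jacobiFibre q J (x : UnitAddCircle))
      (currentFibre q J (x : UnitAddCircle)) t) v‖ ^ 2 ≤
      (2 / (t * ε)) ^ 2 * (q * (2 * R) ^ 2) * ‖v‖ ^ 2 := by
  have h := norm_sub_heisAvg_apply_sq_le (jacobiFibre_floquetEigenbasis q hJ x)
    (fibreQ_floquetEigenbasis q hJ hx) hε ht hgap v
  rw [Fintype.card_fin] at h
  refine h.trans ?_
  have := norm_currentFibre_le q hR (x : UnitAddCircle)
  gcongr

lemma norm_heisAvg_fibre_le (hJ : J.IsPeriodic q) (hR : J.IsRBounded R) (x : ℝ) {t : ℝ}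
    (ht : 0 < t) : ‖heisAvg (jacobiFibre q J (x : UnitAddCircle))
      (currentFibre q J (x : UnitAddCircle)) t‖ ≤ 2 * R :=
  norm_heisAvg_le (fun s => (norm_heis_le (jacobiFibre_floquetEigenbasis q hJ x) s).trans
    (norm_currentFibre_le q hR (x : UnitAddCircle))) ht

lemma exists_pos_le_gap {ι : Type*} [Finite ι] {α : ι → ℝ} (hα : Function.Injective α) :
    ∃ ε > 0, Pairwise fun k l : ι => ε ≤ |α k - α l| := by
  have hev : ∀ᶠ ε in 𝓝[>] (0 : ℝ), ∀ k l : ι, k ≠ l → ε ≤ |α k - α l| := by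
    simp only [Filter.eventually_all]
    intro k l hkl
    filter_upwards [Ioo_mem_nhdsGT (abs_pos.mpr (sub_ne_zero.mpr (hα.ne hkl)))] with ε hε
    exact hε.2.le
  obtain ⟨ε, hgap, hε⟩ := (hev.and self_mem_nhdsWithin).exists
  exact ⟨ε, hε, hgap⟩

lemma tendsto_heisAvg_fibreQ (hJ : J.IsPeriodic q) (hR : J.IsRBounded R)
    (hx : Real.sin (2 * π * x) ≠ 0) :
    Tendsto (heisAvg (jacobiFibre q J (x : UnitAddCircle))
      (currentFibre q J (x : UnitAddCircle))) atTop (𝓝 (fibreQ q J x)) := by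
  obtain ⟨ε, hε, hgap⟩ := exists_pos_le_gap (floquetEig_strictMono q hJ hx).injective
  rw [tendsto_iff_norm_sub_tendsto_zero]
  set C := 2 / ε * √(q * (2 * R) ^ 2) with hC
  have hlim : Tendsto (fun t : ℝ => C * t⁻¹) atTop (𝓝 0) := by
    simpa using tendsto_inv_atTop_zero.const_mul C
  refine squeeze_zero' (.of_forall fun _ => norm_nonneg _) ?_ hlim
  filter_upwards [eventually_gt_atTop 0] with t ht
  rw [norm_sub_rev]
  refine ContinuousLinearMap.opNorm_le_bound _ (by positivity) fun v => ?_
  refine le_of_sq_le_sq ?_ (by positivity)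
  refine (norm_fibreQ_sub_heisAvg_apply_sq_le q hJ hR hx hε ht hgap v).trans_eq ?_
  have hsqrt : √(q * (2 * R) ^ 2) ^ 2 = q * (2 * R) ^ 2 := Real.sq_sqrt (by positivity)
  rw [hC, mul_pow _ ‖v‖, mul_pow _ t⁻¹, mul_pow (2 / ε), hsqrt]
  field_simp

lemma norm_fibreQ_le (hJ : J.IsPeriodic q) (hR : J.IsRBounded R)
    (hx : Real.sin (2 * π * x) ≠ 0) : ‖fibreQ q J x‖ ≤ 2 * R :=
  le_of_tendsto (tendsto_heisAvg_fibreQ q hJ hR hx).norm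
    ((eventually_gt_atTop 0).mono fun _ ht => norm_heisAvg_fibre_le q hJ hR x ht)

end FibreQ

/-! ### Multiplication operators on Floquet space -/

section Circle

/-- `sin 2πθ` as a function on the circle. -/
def circleSin (θ : UnitAddCircle) : ℝ := (fourier 1 θ : ℂ).im

lemma circleSin_coe (x : ℝ) : circleSin (x : UnitAddCircle) = Real.sin (2 * π * x) := by
  have hexp : 2 * π * Complex.I * ((1 : ℤ) : ℂ) * x = ((2 * π * x : ℝ) : ℂ) * Complex.I := by
    push_cast
    ring
  rw [circleSin, fourier_coe_unit, hexp, Complex.exp_ofReal_mul_I_im]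

lemma sin_two_pi_mul_equivIco (θ : UnitAddCircle) :
    Real.sin (2 * π * (AddCircle.equivIco 1 0 θ : ℝ)) = circleSin θ := by
  rw [← circleSin_coe, AddCircle.coe_equivIco]

lemma continuous_circleSin : Continuous circleSin :=
  Complex.continuous_im.comp (fourier 1 : C(UnitAddCircle, ℂ)).continuous

lemma measurableSet_abs_circleSin_lt (σ : ℝ) : MeasurableSet {θ | |circleSin θ| < σ} :=
  (isOpen_lt continuous_circleSin.abs continuous_const).measurableSet

lemma haarAddCircle_eq_volume :
    (AddCircle.haarAddCircle : Measure UnitAddCircle) = (volume : Measure UnitAddCircle) := by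
  have h := AddCircle.volume_eq_smul_haarAddCircle (T := (1 : ℝ))
  rw [ENNReal.ofReal_one, one_smul] at h
  exact h.symm

lemma abs_le_of_abs_sin_two_pi_mul_lt {σ y : ℝ} (hy : |y| ≤ 1 / 4)
    (hsin : |Real.sin (2 * π * y)| < σ) : |y| ≤ σ / 4 := by
  have habs : |2 * π * y| = 2 * π * |y| := by rw [abs_mul, abs_of_pos (by positivity)]
  have hjordan := Real.mul_abs_le_abs_sin (x := 2 * π * y) (by
    rw [habs]
    nlinarith [Real.pi_pos])
  have hcancel : 2 / π * (2 * π * |y|) = 4 * |y| := by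
    field_simp
    ring
  rw [habs, hcancel] at hjordan
  linarith

lemma mem_Icc_union_Icc_of_abs_sin_two_pi_mul_lt {σ x : ℝ} (hx : x ∈ Set.Ioc (-1 / 4 : ℝ) (3 / 4))
    (hsin : |Real.sin (2 * π * x)| < σ) :
    x ∈ Set.Icc (-(σ / 4)) (σ / 4) ∪ Set.Icc (1 / 2 - σ / 4) (1 / 2 + σ / 4) := by
  obtain ⟨hx1, hx2⟩ := hx
  rcases le_or_gt x (1 / 4) with hx3 | hx3
  · exact .inl (abs_le.mp (abs_le_of_abs_sin_two_pi_mul_lt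
      (abs_le.mpr ⟨by linarith, hx3⟩) hsin))
  · have hshift : 2 * π * (x - 1 / 2) = 2 * π * x - π := by ring
    have h := abs_le.mp (abs_le_of_abs_sin_two_pi_mul_lt (y := x - 1 / 2)
      (abs_le.mpr ⟨by linarith, by linarith⟩) (by rwa [hshift, Real.sin_sub_pi, abs_neg]))
    exact .inr ⟨by linarith, by linarith⟩

lemma haarAddCircle_abs_circleSin_lt_le {σ : ℝ} (hσ : 0 ≤ σ) :
    (AddCircle.haarAddCircle : Measure UnitAddCircle) {θ | |circleSin θ| < σ} ≤
      ENNReal.ofReal σ := by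
  have hmeas := measurableSet_abs_circleSin_lt σ
  have hmp := UnitAddCircle.measurePreserving_mk (-1 / 4)
  have hsub : ((↑) : ℝ → UnitAddCircle) ⁻¹' {θ : UnitAddCircle | |circleSin θ| < σ} ∩
      Set.Ioc (-1 / 4) (-1 / 4 + 1) ⊆
      Set.Icc (-(σ / 4)) (σ / 4) ∪ Set.Icc (1 / 2 - σ / 4) (1 / 2 + σ / 4) := by
    rintro x ⟨hsin, hx1, hx2⟩
    refine mem_Icc_union_Icc_of_abs_sin_two_pi_mul_lt ⟨hx1, by linarith⟩ ?_
    rw [← circleSin_coe]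
    exact hsin
  rw [haarAddCircle_eq_volume, ← hmp.measure_preimage hmeas.nullMeasurableSet,
    Measure.restrict_apply (hmp.measurable hmeas)]
  refine (measure_mono hsub).trans ((measure_union_le _ _).trans_eq ?_)
  rw [Real.volume_Icc, Real.volume_Icc, ← ENNReal.ofReal_add (by linarith) (by linarith)]
  congr 1
  ring

lemma ae_circleSin_ne_zero :
    ∀ᵐ θ ∂(AddCircle.haarAddCircle : Measure UnitAddCircle), circleSin θ ≠ 0 := by
  have hlim : Tendsto ENNReal.ofReal (𝓝[>] 0) (𝓝 0) := by
    simpa using (ENNReal.continuous_ofReal.tendsto 0).mono_left nhdsWithin_le_nhds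
  rw [ae_iff, ← nonpos_iff_eq_zero]
  refine ge_of_tendsto hlim (eventually_mem_nhdsWithin.mono fun σ (hσ : 0 < σ) => ?_)
  refine (measure_mono fun θ hθ => ?_).trans (haarAddCircle_abs_circleSin_lt_le hσ.le)
  rw [Set.mem_ofPred_eq, not_not] at hθ
  simpa [hθ] using hσ

end Circle

lemma norm_sq_eq_integral_norm_sq {α E : Type*} {_ : MeasurableSpace α} {μ : Measure α}
    [NormedAddCommGroup E] (f : Lp E 2 μ) : ‖f‖ ^ 2 = ∫ x, ‖f x‖ ^ 2 ∂μ := by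
  have hnonneg : 0 ≤ ∫ x, ‖f x‖ ^ 2 ∂μ := integral_nonneg fun _ => by positivity
  rw [Lp.norm_def, toReal_eLpNorm (Lp.aestronglyMeasurable f),
    lpNorm_eq_integral_norm_rpow_toReal two_ne_zero ENNReal.ofNat_ne_top
      (Lp.aestronglyMeasurable f)]
  simp only [ENNReal.toReal_ofNat, Real.rpow_two]
  rw [← one_div, ← Real.sqrt_eq_rpow, Real.sq_sqrt hnonneg]

lemma integral_le_add_mul_measureReal {α : Type*} {_ : MeasurableSpace α} {μ : Measure α}
    [IsProbabilityMeasure μ] {f : α → ℝ} {a b : ℝ} {B : Set α} (hB : MeasurableSet B)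
    (hf : 0 ≤ᵐ[μ] f) (ha : 0 ≤ a) (hbad : ∀ᵐ x ∂μ, f x ≤ b)
    (hgood : ∀ᵐ x ∂μ, x ∉ B → f x ≤ a) : ∫ x, f x ∂μ ≤ a + b * μ.real B := by
  have hindicator : Integrable (B.indicator fun _ => b) μ := (integrable_const b).indicator hB
  have hle : f ≤ᵐ[μ] fun x => a + B.indicator (fun _ => b) x := by
    filter_upwards [hbad, hgood] with x hxb hxa
    by_cases hx : x ∈ B
    · rw [Set.indicator_of_mem hx]
      linarith
    · rw [Set.indicator_of_notMem hx, add_zero]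
      exact hxa hx
  refine (integral_mono_of_nonneg hf ((integrable_const a).add hindicator) hle).trans_eq ?_
  rw [integral_add' (integrable_const a) hindicator, integral_const, integral_indicator_const _ hB,
    probReal_univ, one_smul, smul_eq_mul, mul_comm]

lemma heisAvg_continuousMap_apply {X 𝔸 : Type*} [TopologicalSpace X] [CompactSpace X]
    [NormedRing 𝔸] [NormedAlgebra ℂ 𝔸] [CompleteSpace 𝔸] (A P : C(X, 𝔸)) (t : ℝ) (x : X) :
    heisAvg A P t x = heisAvg (A x) (P x) t := by
  let eval : C(X, 𝔸) →A[ℂ] 𝔸 :=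
    { toFun := fun M => M x
      map_one' := rfl
      map_zero' := rfl
      map_mul' := fun _ _ => rfl
      map_add' := fun _ _ => rfl
      commutes' := fun _ => rfl
      cont := continuous_eval_const x }
  exact map_heisAvg eval A P t

section DirectIntegral

variable (q : ℕ)

lemma directIntegral_ae {M : UnitAddCircle → Fibre q →L[ℂ] Fibre q}
    (hM : MemLp M ∞ (AddCircle.haarAddCircle : Measure UnitAddCircle)) (f : FloquetSpace q) :
    directIntegral q M f =ᵐ[AddCircle.haarAddCircle] fun θ => M θ (f θ) := by
  rw [directIntegral, dif_pos hM]
  filter_upwards [(ContinuousLinearMap.id ℂ (Fibre q →L[ℂ] Fibre q)).coeFn_holder (r := 2)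
    (hM.toLp M) f, hM.coeFn_toLp] with θ hholder hrep
  rw [hrep] at hholder
  exact hholder

lemma directIntegral_eq_of_ae {M : UnitAddCircle → Fibre q →L[ℂ] Fibre q}
    (hM : MemLp M ∞ (AddCircle.haarAddCircle : Measure UnitAddCircle))
    {T : FloquetSpace q →L[ℂ] FloquetSpace q}
    (hT : ∀ f, T f =ᵐ[AddCircle.haarAddCircle] fun θ => M θ (f θ)) : directIntegral q M = T := by
  ext1 f
  exact Lp.ext ((directIntegral_ae q hM f).trans (hT f).symm)

lemma directIntegral_sub {M N : UnitAddCircle → Fibre q →L[ℂ] Fibre q}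
    (hM : MemLp M ∞ (AddCircle.haarAddCircle : Measure UnitAddCircle))
    (hN : MemLp N ∞ (AddCircle.haarAddCircle : Measure UnitAddCircle)) :
    directIntegral q (M - N) = directIntegral q M - directIntegral q N := by
  refine directIntegral_eq_of_ae q (hM.sub hN) fun f => ?_
  filter_upwards [Lp.coeFn_sub (directIntegral q M f) (directIntegral q N f),
    directIntegral_ae q hM f, directIntegral_ae q hN f] with θ hsub hMf hNf
  rw [sub_apply, hsub, Pi.sub_apply, hMf, hNf, Pi.sub_apply, sub_apply]

lemma memLp_top_continuousMap (M : C(UnitAddCircle, Fibre q →L[ℂ] Fibre q)) :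
    MemLp M ∞ (AddCircle.haarAddCircle : Measure UnitAddCircle) :=
  memLp_top_of_bound M.continuous.aestronglyMeasurable ‖M‖ (.of_forall M.norm_coe_le_norm)

lemma norm_directIntegral_le (M : C(UnitAddCircle, Fibre q →L[ℂ] Fibre q)) :
    ‖directIntegral q M‖ ≤ ‖M‖ := by
  refine ContinuousLinearMap.opNorm_le_bound _ (norm_nonneg M) fun f => ?_
  refine Lp.norm_le_mul_norm_of_ae_le_mul ?_
  filter_upwards [directIntegral_ae q (memLp_top_continuousMap q M) f] with θ hθ
  rw [hθ]
  exact (M θ).le_of_opNorm_le (M.norm_coe_le_norm θ) _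

/-- The linear map underlying `floquetRep`. -/
def floquetRepLinear : C(UnitAddCircle, Fibre q →L[ℂ] Fibre q) →ₗ[ℂ]
    (FloquetSpace q →L[ℂ] FloquetSpace q) where
  toFun M := directIntegral q M
  map_add' M N := directIntegral_eq_of_ae q (memLp_top_continuousMap q (M + N)) fun f => by
    filter_upwards [Lp.coeFn_add (directIntegral q M f) (directIntegral q N f),
      directIntegral_ae q (memLp_top_continuousMap q M) f,
      directIntegral_ae q (memLp_top_continuousMap q N) f] with θ hadd hM hN
    rw [add_apply, hadd, Pi.add_apply, hM, hN, ContinuousMap.add_apply, add_apply]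
  map_smul' c M := directIntegral_eq_of_ae q (memLp_top_continuousMap q (c • M)) fun f => by
    filter_upwards [Lp.coeFn_smul c (directIntegral q M f),
      directIntegral_ae q (memLp_top_continuousMap q M) f] with θ hsmul hM
    exact hsmul.trans (congrArg (c • ·) hM)

/-- The algebra homomorphism underlying `floquetRep`. -/
def floquetRepAlgHom : C(UnitAddCircle, Fibre q →L[ℂ] Fibre q) →ₐ[ℂ]
    (FloquetSpace q →L[ℂ] FloquetSpace q) :=
  AlgHom.ofLinearMap (floquetRepLinear q)
    (directIntegral_eq_of_ae q (memLp_top_continuousMap q 1) (T := 1) fun _ => .rfl)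
    (fun M N => directIntegral_eq_of_ae q (memLp_top_continuousMap q (M * N))
      (T := floquetRepLinear q M * floquetRepLinear q N) fun f => by
        filter_upwards [directIntegral_ae q (memLp_top_continuousMap q N) f,
          directIntegral_ae q (memLp_top_continuousMap q M) (directIntegral q N f)] with θ hN hM
        exact hM.trans (congrArg (M θ) hN))

/-- Continuous families of fibre operators, acting on Floquet space by pointwise
multiplication. -/
def floquetRep : C(UnitAddCircle, Fibre q →L[ℂ] Fibre q) →A[ℂ]
    (FloquetSpace q →L[ℂ] FloquetSpace q) :=
  { floquetRepAlgHom q with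
    cont := AddMonoidHomClass.continuous_of_bound (floquetRepLinear q) 1 fun M =>
      (norm_directIntegral_le q M).trans_eq (one_mul _).symm }

variable [NeZero q] {J : JacobiMatrix}

lemma memLp_circleQ {R : ℝ} (hJ : J.IsPeriodic q) (hR : J.IsRBounded R) :
    MemLp (circleQ q J) ∞ (AddCircle.haarAddCircle : Measure UnitAddCircle) := by
  have hregular : ∀ᵐ θ ∂(AddCircle.haarAddCircle : Measure UnitAddCircle),
      Real.sin (2 * π * (AddCircle.equivIco 1 0 θ : ℝ)) ≠ 0 := by
    filter_upwards [ae_circleSin_ne_zero] with θ hθ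
    rwa [sin_two_pi_mul_equivIco]
  refine memLp_top_of_bound (C := 2 * R) ?_ (hregular.mono fun θ hθ => norm_fibreQ_le q hJ hR hθ)
  let M (n : ℕ) : C(UnitAddCircle, Fibre q →L[ℂ] Fibre q) :=
    heisAvg (jacobiFibre q J) (currentFibre q J) n
  refine aestronglyMeasurable_of_tendsto_ae atTop (f := fun n => M n)
    (fun n => (M n).continuous.aestronglyMeasurable) ?_
  filter_upwards [hregular] with θ hθ
  have h := (tendsto_heisAvg_fibreQ q hJ hR hθ).comp tendsto_natCast_atTop_atTop
  rw [AddCircle.coe_equivIco] at h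
  simp only [M, heisAvg_continuousMap_apply]
  exact h

end DirectIntegral

/-! ### Period-cell operators on `ℓ²(ℤ)` -/

section Delta

/-- The unit vector `δ_n`. -/
def delta (n : ℤ) : L2Z := lp.single 2 n (1 : ℂ)

lemma delta_apply (n m : ℤ) : delta n m = if m = n then 1 else 0 := by
  rw [delta, lp.single_apply, Pi.single_apply]

lemma hasSum_delta (φ : L2Z) : HasSum (fun n : ℤ => φ n • delta n) φ := by
  refine (lp.hasSum_single (p := 2) (by simp) φ).congr_fun fun n => ?_
  rw [delta, ← lp.single_smul, smul_eq_mul, mul_one]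

lemma continuousLinearMap_ext_delta {S T : L2Z →L[ℂ] L2Z} (h : ∀ n, S (delta n) = T (delta n)) :
    S = T := by
  ext1 φ
  have hS := S.hasSum (hasSum_delta φ)
  have hT := T.hasSum (hasSum_delta φ)
  simp only [map_smul, h] at hS hT
  exact hS.unique hT

lemma norm_apply_le_l1norm_mul {φ : L2Z} (hφ : Memℓp (φ : ℤ → ℂ) 1) (T : L2Z →L[ℂ] L2Z) {C : ℝ}
    (hT : ∀ n, ‖T (delta n)‖ ≤ C) : ‖T φ‖ ≤ l1norm φ * C := by
  have hsummable : Summable fun n : ℤ => ‖φ n‖ := by simpa using hφ.summable (by simp)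
  have hsum := T.hasSum (hasSum_delta φ)
  simp only [map_smul] at hsum
  have hle (n : ℤ) : ‖φ n • T (delta n)‖ ≤ ‖φ n‖ * C := by
    rw [norm_smul]
    exact mul_le_mul_of_nonneg_left (hT n) (norm_nonneg _)
  rw [← hsum.tsum_eq, l1norm, ← tsum_mul_right]
  exact tsum_of_norm_bounded (hsummable.mul_right C).hasSum hle

lemma weightedShift_delta (d : ℤ → ℝ) (k : ℤ) (hd : ∃ C, ∀ n, |d n| ≤ C) (n : ℤ) :
    weightedShift d k hd (delta n) = (d (n - k) : ℂ) • delta (n - k) := by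
  ext m
  change (d m : ℂ) * delta n (m + k) = (d (n - k) : ℂ) * delta (n - k) m
  rw [delta_apply, delta_apply]
  by_cases h : m + k = n
  · simp [← h]
  · simp [h, show m ≠ n - k by omega]

lemma JacobiMatrix.op_delta (J : JacobiMatrix) (n : ℤ) :
    J.op (delta n) = (J.a n : ℂ) • delta (n + 1) + (J.b n : ℂ) • delta n +
      (J.a (n - 1) : ℂ) • delta (n - 1) := by
  rw [JacobiMatrix.op, add_apply, add_apply, weightedShift_delta, weightedShift_delta,
    weightedShift_delta, sub_neg_eq_add, add_sub_cancel_right, sub_zero]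

/-- The current operator `i[J, X]` on `ℓ²(ℤ)`. -/
def currentOp (J : JacobiMatrix) : L2Z →L[ℂ] L2Z :=
  Complex.I • (weightedShift J.a 1 J.bdd_a -
    weightedShift (fun n => J.a (n - 1)) (-1) (J.bdd_a.imp fun _ h n => h (n - 1)))

lemma currentOp_apply (J : JacobiMatrix) (φ : L2Z) (n : ℤ) :
    currentOp J φ n =
      Complex.I * ((J.a n : ℂ) * φ (n + 1) - (J.a (n - 1) : ℂ) * φ (n - 1)) := by
  change Complex.I * ((J.a n : ℂ) * φ (n + 1) - (J.a (n - 1) : ℂ) * φ (n + -1)) = _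
  rw [← sub_eq_add_neg]

lemma currentOp_delta (J : JacobiMatrix) (n : ℤ) :
    currentOp J (delta n) = (-(Complex.I * J.a n)) • delta (n + 1) +
      (Complex.I * J.a (n - 1)) • delta (n - 1) := by
  rw [currentOp, FunLike.coe_smul, Pi.smul_apply, sub_apply, weightedShift_delta,
    weightedShift_delta, sub_neg_eq_add, add_sub_cancel_right]
  module

end Delta

section PeriodRep

variable (q : ℕ) [NeZero q] {J : JacobiMatrix}

lemma floquetTransform_delta (n : ℤ) : floquetTransform q (delta n) = floquetVec q n := by
  rw [floquetTransform, delta, HilbertBasis.repr_symm_single, HilbertBasis.coe_mkOfOrthogonalEqBot]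

lemma floquetVec_ae (n : ℤ) :
    floquetVec q n =ᵐ[AddCircle.haarAddCircle] fibreVec q n := floquetVec_coe q n

/-- Continuous families of fibre operators, acting on `ℓ²(ℤ)` through the Floquet transform. -/
def periodRep : C(UnitAddCircle, Fibre q →L[ℂ] Fibre q) →A[ℂ] (L2Z →L[ℂ] L2Z) :=
  ((floquetTransform q).symm.toContinuousLinearEquiv.conjContinuousAlgEquiv :
    (FloquetSpace q →L[ℂ] FloquetSpace q) →A[ℂ] (L2Z →L[ℂ] L2Z)).comp (floquetRep q)

lemma floquetTransform_periodRep (M : C(UnitAddCircle, Fibre q →L[ℂ] Fibre q)) (φ : L2Z) :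
    floquetTransform q (periodRep q M φ) = directIntegral q M (floquetTransform q φ) :=
  (floquetTransform q).apply_symm_apply _

lemma floquetTransform_opQ (φ : L2Z) :
    floquetTransform q (opQ q J φ) = directIntegral q (circleQ q J) (floquetTransform q φ) :=
  (floquetTransform q).apply_symm_apply _

lemma periodRep_delta {M : C(UnitAddCircle, Fibre q →L[ℂ] Fibre q)} {n : ℤ} {α β γ : ℂ}
    (hM : ∀ θ, M θ (fibreVec q n θ) =
      α • fibreVec q (n + 1) θ + β • fibreVec q n θ + γ • fibreVec q (n - 1) θ) :
    periodRep q M (delta n) = α • delta (n + 1) + β • delta n + γ • delta (n - 1) := by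
  apply (floquetTransform q).injective
  simp only [floquetTransform_periodRep, map_add, map_smul, floquetTransform_delta]
  refine Lp.ext ?_
  filter_upwards [directIntegral_ae q (memLp_top_continuousMap q M) (floquetVec q n),
    floquetVec_ae q n, floquetVec_ae q (n + 1), floquetVec_ae q (n - 1),
    Lp.coeFn_add (α • floquetVec q (n + 1) + β • floquetVec q n) (γ • floquetVec q (n - 1)),
    Lp.coeFn_add (α • floquetVec q (n + 1)) (β • floquetVec q n),
    Lp.coeFn_smul α (floquetVec q (n + 1)), Lp.coeFn_smul β (floquetVec q n),
    Lp.coeFn_smul γ (floquetVec q (n - 1))] with θ hint hn hsucc hpred hadd₁ hadd₂ hα hβ hγ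
  simp only [hint, hn, hM, hadd₁, hadd₂, hα, hβ, hγ, hsucc, hpred, Pi.add_apply, Pi.smul_apply]

lemma periodRep_jacobiFibre (hJ : J.IsPeriodic q) : periodRep q (jacobiFibre q J) = J.op := by
  refine continuousLinearMap_ext_delta fun n => ?_
  rw [periodRep_delta q fun θ => jacobiFibre_fibreVec q hJ θ n, J.op_delta]

lemma periodRep_currentFibre (hJ : J.IsPeriodic q) :
    periodRep q (currentFibre q J) = currentOp J := by
  refine continuousLinearMap_ext_delta fun n => ?_
  rw [periodRep_delta q (α := -(Complex.I * J.a n)) (β := 0) (γ := Complex.I * J.a (n - 1))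
    fun θ => by rw [currentFibre_fibreVec q hJ, zero_smul, add_zero], currentOp_delta, zero_smul,
    add_zero]

lemma periodRep_heisAvg (hJ : J.IsPeriodic q) (t : ℝ) :
    periodRep q (heisAvg (jacobiFibre q J) (currentFibre q J) t) =
      heisAvg J.op (currentOp J) t := by
  refine (map_heisAvg (periodRep q) (jacobiFibre q J) (currentFibre q J) t).trans ?_
  rw [periodRep_jacobiFibre q hJ, periodRep_currentFibre q hJ]

lemma norm_opQ_sub_heisAvg_delta_sq {R : ℝ} (hJ : J.IsPeriodic q) (hR : J.IsRBounded R) (t : ℝ)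
    (n : ℤ) : ‖(opQ q J - heisAvg J.op (currentOp J) t) (delta n)‖ ^ 2 =
      ∫ θ, ‖(circleQ q J θ - heisAvg (jacobiFibre q J θ) (currentFibre q J θ) t)
        (fibreVec q n θ)‖ ^ 2 ∂(AddCircle.haarAddCircle : Measure UnitAddCircle) := by
  set M := heisAvg (jacobiFibre q J) (currentFibre q J) t with hM
  have hint := directIntegral_ae q ((memLp_circleQ q hJ hR).sub (memLp_top_continuousMap q M))
    (floquetVec q n)
  rw [← (floquetTransform q).norm_map, sub_apply, map_sub, floquetTransform_opQ,
    ← periodRep_heisAvg q hJ, floquetTransform_periodRep, floquetTransform_delta, ← sub_apply,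
    ← directIntegral_sub q (memLp_circleQ q hJ hR) (memLp_top_continuousMap q _),
    norm_sq_eq_integral_norm_sq]
  refine integral_congr_ae ?_
  filter_upwards [hint, floquetVec_ae q n] with θ hθ hvec
  rw [hθ, hvec, Pi.sub_apply, hM, heisAvg_continuousMap_apply]

/-- A spectral gap controls the fibres with `|sin 2πθ| ≥ σ`; on the others, a set of measure at
most `σ`, the trivial bound `‖Q(θ)‖ + 2R ≤ 4R` has to suffice. -/
theorem norm_opQ_sub_heisAvg_delta_sq_le {R ε σ t : ℝ} (hJ : J.IsPeriodic q)
    (hR : J.IsRBounded R) (hσ : 0 ≤ σ) (hε : 0 < ε) (ht : 0 < t)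
    (hgap : ∀ x : ℝ, Real.sin (2 * π * x) ≠ 0 → σ ≤ |Real.sin (2 * π * x)| →
      Pairwise fun k l : Fin q => ε ≤ |floquetEig q J k x - floquetEig q J l x|) (n : ℤ) :
    ‖(opQ q J - heisAvg J.op (currentOp J) t) (delta n)‖ ^ 2 ≤
      (2 / (t * ε)) ^ 2 * (q * (2 * R) ^ 2) + (4 * R) ^ 2 * σ := by
  have hmeasure :
      (AddCircle.haarAddCircle : Measure UnitAddCircle).real {θ | |circleSin θ| < σ} ≤ σ :=
    ENNReal.toReal_le_of_le_ofReal hσ (haarAddCircle_abs_circleSin_lt_le hσ)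
  rw [norm_opQ_sub_heisAvg_delta_sq q hJ hR]
  refine (integral_le_add_mul_measureReal (a := (2 / (t * ε)) ^ 2 * (q * (2 * R) ^ 2))
    (b := (4 * R) ^ 2) (measurableSet_abs_circleSin_lt σ) (.of_forall fun θ => sq_nonneg _)
    (by positivity) ?_ ?_).trans (by gcongr)
  · filter_upwards [ae_circleSin_ne_zero] with θ hθ
    rw [← sin_two_pi_mul_equivIco] at hθ
    have hQ := norm_fibreQ_le q hJ hR hθ
    have havg := norm_heisAvg_fibre_le q hJ hR (AddCircle.equivIco 1 0 θ : ℝ) ht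
    rw [AddCircle.coe_equivIco] at havg
    have hop := (ContinuousLinearMap.le_opNorm _ (fibreVec q n θ)).trans
      (mul_le_mul_of_nonneg_right ((norm_sub_le _ _).trans (add_le_add hQ havg)) (norm_nonneg _))
    rw [norm_fibreVec, mul_one, ← two_mul, ← mul_assoc, show (2 : ℝ) * 2 = 4 by norm_num] at hop
    exact pow_le_pow_left₀ (norm_nonneg _) hop 2
  · filter_upwards [ae_circleSin_ne_zero] with θ hθ hmem
    rw [← sin_two_pi_mul_equivIco] at hθ
    have hσθ : σ ≤ |Real.sin (2 * π * (AddCircle.equivIco 1 0 θ : ℝ))| := by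
      rw [sin_two_pi_mul_equivIco]
      exact not_lt.mp hmem
    have h := norm_fibreQ_sub_heisAvg_apply_sq_le q hJ hR hθ hε ht (hgap _ hθ hσθ)
      (fibreVec q n θ)
    rwa [AddCircle.coe_equivIco, norm_fibreVec, one_pow, mul_one] at h

end PeriodRep

/-! ### The Heisenberg evolution of the position operator -/

section ExpSeries

variable {E F : Type*} [NormedAddCommGroup E] [NormedSpace ℂ E] [CompleteSpace E]
  [NormedAddCommGroup F] [NormedSpace ℂ F] [CompleteSpace F]

lemma hasSum_expI_apply (A : E →L[ℂ] E) (s : ℝ) (v : E) :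
    HasSum (fun n : ℕ => ((n.factorial : ℂ)⁻¹ * (Complex.I * s) ^ n) • (A ^ n) v)
      (expI A s v) := by
  have hexp := NormedSpace.exp_series_hasSum_exp' (𝕂 := ℂ) ((Complex.I * (s : ℂ)) • A)
  refine ((ContinuousLinearMap.apply ℂ E v).hasSum hexp).congr_fun fun n => ?_
  rw [smul_pow, smul_smul]
  rfl

lemma expI_apply_mem {A : E →L[ℂ] E} {S : Submodule ℂ E} (hS : IsClosed (S : Set E))
    (hA : ∀ v ∈ S, A v ∈ S) (s : ℝ) {v : E} (hv : v ∈ S) : expI A s v ∈ S := by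
  have hpow (n : ℕ) : (A ^ n) v ∈ S := by
    induction n with
    | zero => exact hv
    | succ n ih =>
      rw [pow_succ']
      exact hA _ ih
  exact hS.mem_of_tendsto (hasSum_expI_apply A s v)
    (.of_forall fun T => S.sum_mem fun n _ => S.smul_mem _ (hpow n))

lemma map_expI_apply {A : E →L[ℂ] E} {B : F →L[ℂ] F} (L : E →L[ℂ] F)
    (hL : ∀ v, L (A v) = B (L v)) (s : ℝ) (v : E) : L (expI A s v) = expI B s (L v) := by
  have hpow (n : ℕ) : L ((A ^ n) v) = (B ^ n) (L v) := by
    induction n with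
    | zero => rfl
    | succ n ih => rw [pow_succ', pow_succ', mul_apply_eq_comp, mul_apply_eq_comp, hL, ih]
  have hsum := L.hasSum (hasSum_expI_apply A s v)
  simp only [map_smul, hpow] at hsum
  exact hsum.unique (hasSum_expI_apply B s (L v))

lemma continuous_heis_apply (A P : E →L[ℂ] E) (v : E) : Continuous fun s => heis A P s v :=
  (ContinuousLinearMap.apply ℂ E v).continuous.comp (continuous_heis A P)

lemma smul_heisAvg_apply (A P : E →L[ℂ] E) {t : ℝ} (ht : t ≠ 0) (v : E) :
    (t : ℂ) • heisAvg A P t v = ∫ s in (0 : ℝ)..t, heis A P s v := by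
  have hcancel : (t : ℂ) * ((1 / t : ℝ) : ℂ) = 1 := by
    rw [← Complex.ofReal_mul, mul_one_div_cancel ht, Complex.ofReal_one]
  rw [heisAvg, FunLike.coe_smul, Pi.smul_apply, smul_smul, hcancel, one_smul]
  exact ((ContinuousLinearMap.apply ℂ E v).intervalIntegral_comp_comm
    ((continuous_heis A P).intervalIntegrable (μ := volume) 0 t)).symm

end ExpSeries

section Position

lemma mem_graph_positionOp {v : L2Z × L2Z} :
    v ∈ positionOp.graph ↔ ∀ m : ℤ, v.2 m = (m : ℂ) * v.1 m := by
  rw [LinearPMap.mem_graph_iff]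
  constructor
  · rintro ⟨φ, hfst, hsnd⟩ m
    rw [← hfst, ← hsnd]
    rfl
  · intro hv
    have hdom : Memℓp (fun m : ℤ => (m : ℂ) * v.1 m) 2 := by
      rw [← funext hv]
      exact lp.memℓp v.2
    exact ⟨⟨v.1, hdom⟩, rfl, lp.ext (funext fun m => (hv m).symm)⟩

lemma isClosed_positionOp : positionOp.IsClosed := by
  have heval (m : ℤ) : Continuous fun φ : L2Z => φ m :=
    (lp.evalCLM ℂ (fun _ : ℤ => ℂ) 2 m).continuous
  have hgraph : (positionOp.graph : Set (L2Z × L2Z)) =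
      ⋂ m : ℤ, {v : L2Z × L2Z | v.2 m = (m : ℂ) * v.1 m} := by
    ext v
    rw [Set.mem_iInter]
    exact mem_graph_positionOp
  rw [LinearPMap.IsClosed, hgraph]
  exact isClosed_iInter fun m => isClosed_eq ((heval m).comp continuous_snd)
    (continuous_const.mul ((heval m).comp continuous_fst))

variable (J : JacobiMatrix)

/-- The bounded generator `(φ, ψ) ↦ (Jφ, Jψ + iCφ)` on `ℓ² × ℓ²`, where `C = i[J, X]` is the
current operator. Since `XJ = JX + iC`, it governs the joint evolution of `(φ, Xφ)`, so that its
exponential stands in for conjugation by the unbounded `X`. -/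
def positionGenerator : (L2Z × L2Z) →L[ℂ] (L2Z × L2Z) :=
  (J.op ∘L ContinuousLinearMap.fst ℂ L2Z L2Z).prod
    (Complex.I • (currentOp J ∘L ContinuousLinearMap.fst ℂ L2Z L2Z) +
      J.op ∘L ContinuousLinearMap.snd ℂ L2Z L2Z)

lemma positionGenerator_mem_graph {v : L2Z × L2Z} (hv : v ∈ positionOp.graph) :
    positionGenerator J v ∈ positionOp.graph := by
  rw [mem_graph_positionOp] at hv ⊢
  intro m
  change Complex.I * currentOp J v.1 m + J.op v.2 m = (m : ℂ) * J.op v.1 m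
  rw [currentOp_apply, J.op_apply, J.op_apply, hv, hv, hv]
  push_cast
  linear_combination ((J.a m : ℂ) * v.1 (m + 1) - (J.a (m - 1) : ℂ) * v.1 (m - 1)) * Complex.I_sq

lemma fst_expI_positionGenerator (s : ℝ) (v : L2Z × L2Z) :
    (expI (positionGenerator J) s v).1 = expI J.op s v.1 :=
  map_expI_apply (ContinuousLinearMap.fst ℂ L2Z L2Z) (fun _ => rfl) s v

lemma hasDerivAt_snd_expI_positionGenerator_neg (v : L2Z × L2Z) (s : ℝ) :
    HasDerivAt (fun s => (expI (positionGenerator J) (-s) v).2)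
      (currentOp J (expI J.op (-s) v.1) -
        Complex.I • J.op (expI (positionGenerator J) (-s) v).2) s := by
  let 𝒥 := positionGenerator J
  let L : ((L2Z × L2Z) →L[ℂ] (L2Z × L2Z)) →L[ℂ] L2Z :=
    ContinuousLinearMap.snd ℂ L2Z L2Z ∘L ContinuousLinearMap.apply ℂ (L2Z × L2Z) v
  have hexp : HasDerivAt (fun s => expI 𝒥 (-s)) (-(Complex.I • (𝒥 * expI 𝒥 (-s)))) s := by
    simpa [Function.comp_def] using (hasDerivAt_expI 𝒥 (-s)).scomp s (hasDerivAt_neg s)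
  refine ((L.restrictScalars ℝ).hasFDerivAt.comp_hasDerivAt s hexp).congr_deriv ?_
  change -(Complex.I • (Complex.I • currentOp J (expI 𝒥 (-s) v).1 + J.op (expI 𝒥 (-s) v).2)) = _
  rw [fst_expI_positionGenerator, smul_add, smul_smul, Complex.I_mul_I]
  module

lemma hasDerivAt_expI_snd_expI_positionGenerator (v : L2Z × L2Z) (s : ℝ) :
    HasDerivAt (fun s => expI J.op s (expI (positionGenerator J) (-s) v).2)
      (heis J.op (currentOp J) s v.1) s := by
  have hexp : HasDerivAt (fun s => (expI J.op s).restrictScalars ℝ)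
      ((Complex.I • (J.op * expI J.op s)).restrictScalars ℝ) s :=
    (ContinuousLinearMap.restrictScalarsL ℂ L2Z L2Z ℝ ℝ).hasFDerivAt.comp_hasDerivAt
      s (hasDerivAt_expI J.op s)
  refine (hexp.clm_apply (hasDerivAt_snd_expI_positionGenerator_neg J v s)).congr_deriv ?_
  rw [(commute_expI J.op s).eq]
  change Complex.I • expI J.op s (J.op _) + expI J.op s (_ - Complex.I • J.op _) = _
  rw [map_sub, map_smul, add_sub_cancel]
  rfl

lemma expI_snd_expI_positionGenerator_eq_add_integral (t : ℝ) (v : L2Z × L2Z) :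
    expI J.op t (expI (positionGenerator J) (-t) v).2 =
      v.2 + ∫ s in (0 : ℝ)..t, heis J.op (currentOp J) s v.1 := by
  rw [intervalIntegral.integral_eq_sub_of_hasDerivAt
    (fun s _ => hasDerivAt_expI_snd_expI_positionGenerator J v s)
    ((continuous_heis_apply J.op (currentOp J) v.1).intervalIntegrable 0 t), neg_zero, expI_zero,
    expI_zero]
  exact (add_sub_cancel v.2 _).symm

theorem exists_heisenbergX_eq {t : ℝ} (ht : t ≠ 0) {φ : L2Z} (hφ : φ ∈ positionOp.domain) :
    ∃ hφt : φ ∈ (heisenbergX J t).domain, heisenbergX J t ⟨φ, hφt⟩ =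
      positionOp ⟨φ, hφ⟩ + (t : ℂ) • heisAvg J.op (currentOp J) t φ := by
  let v : L2Z × L2Z := (φ, positionOp ⟨φ, hφ⟩)
  have hmem : expI (positionGenerator J) (-t) v ∈ positionOp.graph :=
    expI_apply_mem isClosed_positionOp (fun _ => positionGenerator_mem_graph J) (-t)
      (positionOp.mem_graph ⟨φ, hφ⟩)
  obtain ⟨⟨ψ, hψ⟩, hfst, hsnd⟩ := (LinearPMap.mem_graph_iff _).mp hmem
  obtain rfl : ψ = expI J.op (-t) φ := hfst.trans (fst_expI_positionGenerator J (-t) v)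
  refine ⟨hψ, ?_⟩
  rw [smul_heisAvg_apply _ _ ht]
  calc heisenbergX J t ⟨φ, hψ⟩ = expI J.op t (positionOp ⟨expI J.op (-t) φ, hψ⟩) := rfl
    _ = expI J.op t (expI (positionGenerator J) (-t) v).2 := by rw [hsnd]
    _ = _ := expI_snd_expI_positionGenerator_eq_add_integral J t v

end Position

/-! ### Periodic approximation -/

section Approximation

lemma norm_apply_delta_le (T : L2Z →L[ℂ] L2Z) (n m : ℤ) : ‖T (delta n) m‖ ≤ ‖T‖ := by
  have hdelta : ‖delta n‖ = 1 := by rw [delta, lp.norm_single (by norm_num), norm_one]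
  have hT := T.le_opNorm (delta n)
  rw [hdelta, mul_one] at hT
  exact (lp.norm_apply_le_norm two_ne_zero _ m).trans hT

lemma norm_a_sub_le (J J' : JacobiMatrix) (n : ℤ) : ‖(J.a n : ℂ) - J'.a n‖ ≤ ‖J.op - J'.op‖ := by
  have hentry : (J.op - J'.op) (delta n) (n + 1) = (J.a n : ℂ) - J'.a n := by
    change J.op (delta n) (n + 1) - J'.op (delta n) (n + 1) = _
    simp [J.op_apply, J'.op_apply, delta_apply, show n + 1 + 1 ≠ n by omega]
  exact hentry ▸ norm_apply_delta_le (J.op - J'.op) n (n + 1)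

lemma norm_b_sub_le (J J' : JacobiMatrix) (n : ℤ) : ‖(J.b n : ℂ) - J'.b n‖ ≤ ‖J.op - J'.op‖ := by
  have hentry : (J.op - J'.op) (delta n) n = (J.b n : ℂ) - J'.b n := by
    change J.op (delta n) n - J'.op (delta n) n = _
    simp [J.op_apply, J'.op_apply, delta_apply, show n - 1 ≠ n by omega]
  exact hentry ▸ norm_apply_delta_le (J.op - J'.op) n n

lemma norm_jacobiFibre_sub_le (q : ℕ) [NeZero q] (J J' : JacobiMatrix) (θ : UnitAddCircle) :
    ‖jacobiFibre q J θ - jacobiFibre q J' θ‖ ≤ 3 * ‖J.op - J'.op‖ := by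
  have hsub : jacobiFibre q J θ - jacobiFibre q J' θ = triFibre q (fun n => (J.a n : ℂ) - J'.a n)
      (fun n => (J.b n : ℂ) - J'.b n) (fun n => (J.a (n - 1) : ℂ) - J'.a (n - 1)) θ := by
    ext1 v
    rw [sub_apply, jacobiFibre, jacobiFibre, triFibre_apply, triFibre_apply, triFibre_apply,
      ← Finset.sum_sub_distrib]
    refine Finset.sum_congr rfl fun k _ => ?_
    rw [← smul_sub]
    congr 1
    module
  calc ‖jacobiFibre q J θ - jacobiFibre q J' θ‖
      ≤ ‖J.op - J'.op‖ + ‖J.op - J'.op‖ + ‖J.op - J'.op‖ := hsub ▸ norm_triFibre_le q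
        (norm_a_sub_le J J') (norm_b_sub_le J J') (fun n => norm_a_sub_le J J' (n - 1)) θ
    _ = 3 * ‖J.op - J'.op‖ := by ring

lemma JacobiMatrix.IsPeriodic.mul {p : ℕ} {J : JacobiMatrix} (hJ : J.IsPeriodic p) (r : ℕ) :
    J.IsPeriodic (p * r) := by
  intro n
  have hcast : ((p * r : ℕ) : ℤ) = r * p := by
    push_cast
    ring
  rw [hcast]
  exact ⟨hJ.periodic_a.nat_mul r n, hJ.periodic_b.nat_mul r n⟩

lemma abs_floquetEig_sub_le (q : ℕ) [NeZero q] {J J' : JacobiMatrix} (hJ : J.IsPeriodic q)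
    (hJ' : J'.IsPeriodic q) (k : Fin q) (x : ℝ) :
    |floquetEig q J k x - floquetEig q J' k x| ≤ 3 * ‖J.op - J'.op‖ :=
  (abs_eigenvalue_sub_le_opNorm_sub (floquetEig_monotone q J x) (floquetEig_monotone q J' x)
    (jacobiFibre_floquetEigenbasis q hJ x) (jacobiFibre_floquetEigenbasis q hJ' x) k).trans
    (norm_jacobiFibre_sub_le q J J' x)

section SmallerPeriod

variable {R c ε : ℝ} {p q r : ℕ} [NeZero p] [NeZero q] {J J' : JacobiMatrix}

lemma three_mul_le_gap (hL : IsLastConstant R c) (hq : q = p * r) (hp : 6 ≤ p)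
    (hJ' : J'.IsPeriodic p) (hR' : J'.IsRBounded R) (hε : 0 < ε) {x : ℝ}
    (hx : Real.sin (2 * π * x) ≠ 0)
    (hσ : q * Real.exp (c * p / 2) * √ε ≤ |Real.sin (2 * π * x)|) {k l : Fin q} (hkl : k ≠ l) :
    3 * ε ≤ |floquetEig q J' k x - floquetEig q J' l x| := by
  set g := |floquetEig q J' k x - floquetEig q J' l x|
  have hr : (0 : ℝ) < r := by
    have : r ≠ 0 := by
      rintro rfl
      exact NeZero.ne q hq
    positivity
  have hexp : Real.exp (c * p / 2) ^ 2 = Real.exp (c * p) := by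
    rw [← Real.exp_nat_mul]
    congr 1
    push_cast
    ring
  have hcompare : (r ^ 2 * Real.exp (c * p)) * (p ^ 2 * ε) ≤
      (r ^ 2 * Real.exp (c * p)) * (2 * π * g) := by
    calc (r ^ 2 * Real.exp (c * p)) * (p ^ 2 * ε)
        = (q * Real.exp (c * p / 2) * √ε) ^ 2 := by
          rw [mul_pow, mul_pow, hexp, Real.sq_sqrt hε.le, hq, Nat.cast_mul]
          ring
      _ ≤ Real.sin (2 * π * x) ^ 2 := by
          rw [← sq_abs (Real.sin (2 * π * x))]
          gcongr
      _ ≤ r ^ 2 * (2 * π * Real.exp (c * p)) * g :=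
          sin_sq_le_mul_gap hL hq hJ' (hq ▸ hJ'.mul r) hR' hx hkl
      _ = (r ^ 2 * Real.exp (c * p)) * (2 * π * g) := by ring
  have hp' : (6 : ℝ) ^ 2 * ε ≤ p ^ 2 * ε := by
    gcongr
    exact_mod_cast hp
  have hg := hp'.trans (le_of_mul_le_mul_left hcompare (by positivity))
  nlinarith [Real.pi_lt_four, abs_nonneg (floquetEig q J' k x - floquetEig q J' l x)]

lemma le_gap_of_norm_sub_le (hL : IsLastConstant R c) (hq : q = p * r) (hp : 6 ≤ p)
    (hJ : J.IsPeriodic q) (hJ' : J'.IsPeriodic p) (hR' : J'.IsRBounded R) (hε : 0 < ε)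
    (hclose : 3 * ‖J.op - J'.op‖ ≤ ε) {x : ℝ} (hx : Real.sin (2 * π * x) ≠ 0)
    (hσ : q * Real.exp (c * p / 2) * √ε ≤ |Real.sin (2 * π * x)|) {k l : Fin q} (hkl : k ≠ l) :
    ε ≤ |floquetEig q J k x - floquetEig q J l x| := by
  have hk := (abs_floquetEig_sub_le q hJ (hq ▸ hJ'.mul r) k x).trans hclose
  have hl := (abs_floquetEig_sub_le q hJ (hq ▸ hJ'.mul r) l x).trans hclose
  have hgap := three_mul_le_gap hL hq hp hJ' hR' hε hx hσ hkl
  have htri := abs_sub_le (floquetEig q J' k x) (floquetEig q J k x) (floquetEig q J' l x)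
  have htri' := abs_sub_le (floquetEig q J k x) (floquetEig q J l x) (floquetEig q J' l x)
  rw [abs_sub_comm (floquetEig q J' k x) (floquetEig q J k x)] at htri
  linarith

lemma norm_opQ_sub_heisAvg_delta_le (hL : IsLastConstant R c) (hq : q = p * r) (hp : 6 ≤ p)
    (hJ : J.IsPeriodic q) (hR : J.IsRBounded R) (hJ' : J'.IsPeriodic p) (hR' : J'.IsRBounded R)
    (hε : 0 < ε) (hclose : 3 * ‖J.op - J'.op‖ ≤ ε) {t : ℝ} (ht : 0 < t) (n : ℤ) :
    ‖(opQ q J - heisAvg J.op (currentOp J) t) (delta n)‖ ≤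
      √(4 * R ^ 2 * (q : ℝ) ^ 2 / (t ^ 2 * ε ^ 2) +
        16 * R ^ 2 * (q : ℝ) * Real.exp (c * p / 2) * √ε) := by
  have hq4 : (4 : ℝ) ≤ q := by
    have hpq : p ≤ q := Nat.le_of_dvd (Nat.pos_of_ne_zero (NeZero.ne q)) ⟨r, hq⟩
    exact_mod_cast (by omega : 4 ≤ q)
  refine Real.le_sqrt_of_sq_le ((norm_opQ_sub_heisAvg_delta_sq_le q
    (σ := q * Real.exp (c * p / 2) * √ε) hJ hR (by positivity) hε ht
    (fun x hx hσ k l hkl => le_gap_of_norm_sub_le hL hq hp hJ hJ' hR' hε hclose hx hσ hkl)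
    n).trans (add_le_add ?_ (le_of_eq (by ring))))
  calc (2 / (t * ε)) ^ 2 * (q * (2 * R) ^ 2) = 4 * R ^ 2 * (4 * q) / (t ^ 2 * ε ^ 2) := by ring
    _ ≤ 4 * R ^ 2 * (q : ℝ) ^ 2 / (t ^ 2 * ε ^ 2) := by
      rw [sq (q : ℝ)]
      gcongr

end SmallerPeriod

lemma norm_opQ_sub_heisenbergX_le {J : JacobiMatrix} {q : ℕ} [NeZero q] {t C : ℝ} (ht : 0 < t)
    (hC : ∀ n, ‖(opQ q J - heisAvg J.op (currentOp J) t) (delta n)‖ ≤ C) {φ : L2Z}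
    (hφ1 : Memℓp (φ : ℤ → ℂ) 1) (hφ : φ ∈ positionOp.domain) :
    ∃ hφt : φ ∈ (heisenbergX J t).domain,
      ‖opQ q J φ - ((1 / t : ℝ) : ℂ) • heisenbergX J t ⟨φ, hφt⟩‖ ≤
        1 / t * ‖positionOp ⟨φ, hφ⟩‖ + l1norm φ * C := by
  obtain ⟨hφt, hX⟩ := exists_heisenbergX_eq J ht.ne' hφ
  have hcancel : ((1 / t : ℝ) : ℂ) * (t : ℂ) = 1 := by
    rw [← Complex.ofReal_mul, one_div_mul_cancel ht.ne', Complex.ofReal_one]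
  have hsplit : opQ q J φ - ((1 / t : ℝ) : ℂ) • heisenbergX J t ⟨φ, hφt⟩ =
      (opQ q J - heisAvg J.op (currentOp J) t) φ - ((1 / t : ℝ) : ℂ) • positionOp ⟨φ, hφ⟩ := by
    rw [hX, smul_add, smul_smul, hcancel, one_smul, sub_apply]
    abel
  have hpos : ‖((1 / t : ℝ) : ℂ) • positionOp ⟨φ, hφ⟩‖ = 1 / t * ‖positionOp ⟨φ, hφ⟩‖ := by
    rw [norm_smul, Complex.norm_real, Real.norm_of_nonneg (by positivity)]
  refine ⟨hφt, ?_⟩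
  rw [hsplit, add_comm, ← hpos]
  exact (norm_sub_le _ _).trans (add_le_add_left (norm_apply_le_l1norm_mul hφ1 _ hC) _)

lemma gam_pos (η : ℝ) (q : ℕ → ℕ) (n : ℕ) [NeZero (q n)] : 0 < gam η q n :=
  div_pos (Real.exp_pos _) (pow_pos (Nat.cast_pos.mpr (NeZero.pos (q n))) 3)

namespace JacobiMatrix.IsExpApprox

variable {η : ℝ} {J : JacobiMatrix} {q : ℕ → ℕ} {Jq : ℕ → JacobiMatrix} [∀ n, NeZero (q n)]

lemma strictMono (h : IsExpApprox η J q Jq) : StrictMono q :=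
  strictMono_nat_of_lt_succ fun n => lt_of_le_of_ne
    (Nat.le_of_dvd (Nat.pos_of_ne_zero (NeZero.ne _)) (h.dvd n)) (h.ne n)

lemma eventually_three_mul_norm_sub_le (h : IsExpApprox η J q Jq) (hη : 0 ≤ η) :
    ∀ᶠ n in atTop, 3 * ‖(Jq (n + 1)).op - (Jq n).op‖ ≤ gam η q (n + 1) := by
  have hsmall : ∀ᶠ n in atTop,
      (q (n + 1) : ℝ) ^ 3 * Real.exp (η * q n) * ‖J.op - (Jq n).op‖ < 1 / 6 :=
    h.tendsto.eventually_lt_const (by norm_num)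
  filter_upwards [hsmall, (tendsto_add_atTop_nat 1).eventually hsmall] with n hn hn'
  have hle (m : ℕ) : q m ≤ q (m + 1) := h.strictMono.monotone (Nat.le_succ m)
  have hpos : (0 : ℝ) < q (n + 1) := by exact_mod_cast Nat.pos_of_ne_zero (NeZero.ne (q (n + 1)))
  set M := (q (n + 1) : ℝ) ^ 3 * Real.exp (η * q n) with hM
  have hM0 : 0 < M := by positivity
  have hn'' : M * ‖J.op - (Jq (n + 1)).op‖ < 1 / 6 := by
    refine lt_of_le_of_lt ?_ hn'
    rw [hM]
    gcongr <;> exact hle _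
  have hgam : gam η q (n + 1) = 1 / M := by
    rw [gam, Nat.add_sub_cancel, Real.exp_neg, hM]
    field_simp
  have htri : ‖(Jq (n + 1)).op - (Jq n).op‖ ≤ ‖J.op - (Jq (n + 1)).op‖ + ‖J.op - (Jq n).op‖ := by
    rw [norm_sub_rev J.op (Jq (n + 1)).op]
    exact norm_sub_le_norm_sub_add_norm_sub _ _ _
  rw [hgam, le_div_iff₀ hM0]
  nlinarith [mul_le_mul_of_nonneg_left htri hM0.le]

end JacobiMatrix.IsExpApprox

end Approximation

end JacobiTransport

end

theorem corollary4p2_general {R c₁ η : ℝ} (hL : JacobiTransport.IsLastConstant R c₁) (hη : 0 ≤ η)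
    {J : JacobiTransport.JacobiMatrix} {q : ℕ → ℕ} [∀ n, NeZero (q n)]
    {Jq : ℕ → JacobiTransport.JacobiMatrix}
    (hExp : JacobiTransport.JacobiMatrix.IsExpApprox η J q Jq)
    (hbdd : ∀ᶠ n in atTop, (Jq n).IsRBounded R) :
    ∃ N : ℕ, 1 ≤ N ∧ ∀ n : ℕ, N ≤ n →
      MemLp (JacobiTransport.circleQ (q n) (Jq n)) ∞
        (AddCircle.haarAddCircle : Measure UnitAddCircle) ∧
      ∀ (t ε : ℝ) (φ : JacobiTransport.L2Z),
        0 < t → JacobiTransport.gam η q n ≤ ε →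
        Memℓp (φ : ℤ → ℂ) 1 → ∀ hφ : φ ∈ JacobiTransport.positionOp.domain,
        ∃ hφt : φ ∈ (JacobiTransport.heisenbergX (Jq n) t).domain,
          ‖JacobiTransport.opQ (q n) (Jq n) φ -
              ((1 / t : ℝ) : ℂ) • JacobiTransport.heisenbergX (Jq n) t ⟨φ, hφt⟩‖ ≤
            1 / t * ‖JacobiTransport.positionOp ⟨φ, hφ⟩‖ +
            JacobiTransport.l1norm φ *
              √(4 * R ^ 2 * (q n : ℝ) ^ 2 / (t ^ 2 * ε ^ 2) +
                16 * R ^ 2 * (q n : ℝ) * Real.exp (c₁ * q (n - 1) / 2) * √ε) := by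
  obtain ⟨N, hN⟩ := eventually_atTop.mp
    ((hbdd.and (hExp.eventually_three_mul_norm_sub_le hη)).and (eventually_ge_atTop 6))
  refine ⟨N + 1, Nat.le_add_left 1 N, fun n hn => ?_⟩
  obtain ⟨m, rfl⟩ : ∃ m, n = m + 1 := ⟨n - 1, by omega⟩
  obtain ⟨⟨hRm, hclose⟩, hm6⟩ := hN m (by omega)
  have hRn := (hN (m + 1) (by omega)).1.1
  have hp : 6 ≤ q m := hm6.trans hExp.strictMono.le_apply
  obtain ⟨r, hr⟩ := hExp.dvd m
  refine ⟨JacobiTransport.memLp_circleQ (q (m + 1)) (hExp.periodic (m + 1)) hRn,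
    fun t ε φ ht hε hφ1 hφ => ?_⟩
  have hε0 : 0 < ε := (JacobiTransport.gam_pos η q (m + 1)).trans_le hε
  exact JacobiTransport.norm_opQ_sub_heisenbergX_le ht
    (JacobiTransport.norm_opQ_sub_heisAvg_delta_le hL hr hp (hExp.periodic (m + 1)) hRn
      (hExp.periodic m) hRm hε0 (hclose.trans hε) ht) hφ1 hφ

theorem corollary4p2 (R : ℝ) (hR : 0 < R) :
    (∃ c : ℝ, 0 < c ∧ JacobiTransport.IsLastConstant R c) ∧
      ∀ c₁ : ℝ, 0 < c₁ → JacobiTransport.IsLastConstant R c₁ →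
      ∀ η : ℝ, 7 * c₁ < η →
      ∀ (J : JacobiTransport.JacobiMatrix) (q : ℕ → ℕ) [∀ n, NeZero (q n)]
        (Jq : ℕ → JacobiTransport.JacobiMatrix),
        J.IsRBounded R → JacobiTransport.JacobiMatrix.IsExpApprox η J q Jq →
        (∀ᶠ n in atTop, (Jq n).IsRBounded R) →
        ∃ N : ℕ, 1 ≤ N ∧ ∀ n : ℕ, N ≤ n →
          MemLp (JacobiTransport.circleQ (q n) (Jq n)) ∞
            (AddCircle.haarAddCircle : Measure UnitAddCircle) ∧
          ∀ (t ε : ℝ) (φ : JacobiTransport.L2Z),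
            0 < t → JacobiTransport.gam η q n < ε →
            Memℓp (φ : ℤ → ℂ) 1 → ∀ hφ : φ ∈ JacobiTransport.positionOp.domain,
            ∃ hφt : φ ∈ (JacobiTransport.heisenbergX (Jq n) t).domain,
              ‖JacobiTransport.opQ (q n) (Jq n) φ -
                  ((1 / t : ℝ) : ℂ) • JacobiTransport.heisenbergX (Jq n) t ⟨φ, hφt⟩‖ ≤
                1 / t * ‖JacobiTransport.positionOp ⟨φ, hφ⟩‖ +
                JacobiTransport.l1norm φ *
                  √(4 * R ^ 2 * (q n : ℝ) ^ 2 / (t ^ 2 * ε ^ 2) +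
                    16 * R ^ 2 * (q n : ℝ) * Real.exp (c₁ * q (n - 1) / 2) * √ε) :=
  ⟨JacobiTransport.exists_isLastConstant hR, fun _ hc₁ hL _ hη _ _ _ _ _ hExp hbdd =>
    have ⟨N, hN, hbound⟩ := corollary4p2_general hL (by linarith) hExp hbdd
    ⟨N, hN, fun n hn => ⟨(hbound n hn).1, fun t ε φ ht hε => (hbound n hn).2 t ε φ ht hε.le⟩⟩⟩
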